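/- Let $p$ be a prime, $q=p^k$ with $k\ge 1$, and let $C$ be an algebraically closed field containing $\mathbb F_q$ which is complete with respect to a non-archimedean absolute value $|\cdot|$. Put $\Delta_r=\{x\in C:|x|\le r\}$, $v(z)=-\log|z|$ for $z\neq 0$ and $v(0)=+\infty$. Let $E=\{mp^n : m,n\in\mathbb Z,\ m\ge 0\}$; for $e=mp^n\in E$ and $z\in C$ put $z^e=(z^{p^n})^m$, where for $n<0$ the element $z^{p^n}$ is the unique $p^{-n}$-th root of $z$ in $C$. Let $\mathcal P$ be the set of series $f=\sum_{e\in E}a_ez^e$ with $a_e\in C$ that converge at every $z\in C$ (i.e. for every $z\in C$ and $r>0$ only finitely many terms have absolute value greater than $r$), and let $\mathcal F\subseteq\mathcal P$ be the set of those of the form $f=\sum_{n\in\mathbb Z}a_nz^{q^n}$, also written $f=\sum_{n\in\mathbb Z}a_n\tau^n$. A series is constant if $a_e=0$ for all $e\ne 0$. For $r>0$, let $\mathcal G$ be the collection of $\mathbb F_q$-subspaces $G$ of $C$ such that (1) $G\cap\Delta_r$ is compact; (2) $\int_{G\cap\Delta_r}v=+\infty$, the integral being with respect to any Haar measure on $G\cap\Delta_r$;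 (3) $G\cap\Delta_r$ has finite or countable index in $G$ and, in the latter case, if $g_1,g_2,\dots$ is a system of coset representatives, then $\lim_{n\to\infty}|g_n|=+\infty$. Theorem. (a) If $f=\sum_{e\in E}a_ez^e\in\mathcal P$ is not constant, then for each $c\in C$ the fiber $f^{-1}(c)=\{z\in C: f(z)=c\}$ is a locally compact subset of $C$, and it is compact if and only if there is a largest $e\in E$ with $a_e\neq 0$. (b) If $f=\sum_{n\in\mathbb Z}a_n\tau^n\in\mathcal F$ is nonzero, then $G=\ker f=\{z\in C:f(z)=0\}$ is an $\mathbb F_q$-subspace of $C$ belonging to $\mathcal G$ (for every choice of $r>0$). Moreover, $G$ is discrete if and only if there is $N\in\mathbb Z$ with $a_n=0$ for all $n<N$, and $G$ is compact if and only if there is $N\in\mathbb Z$ with $a_n=0$ for all $n>N$. -/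

import Mathlib

open MeasureTheory Filter Topology

namespace FracSeries

/-- The set of exponents `E = {m p ^ n : m, n ∈ ℤ, m ≥ 0}`. -/
def Exponents (p : ℕ) : Set ℚ := {e | ∃ m : ℕ, ∃ n : ℤ, e = m * (p : ℚ) ^ n}

section Field

variable {C : Type*} [NormedField C] [IsAlgClosed C]
variable (p : ℕ) [Fact p.Prime] [CharP C p]

/-- `z ^ (m p ^ n)` for `n : ℤ`: the `m`-th power of the image of `z` under the `n`-th iterate
of the bijective Frobenius map `z ↦ z ^ p` of `C`. -/
noncomputable def monomialPow (z : C) (m : ℕ) (n : ℤ) : C :=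
  (((frobeniusEquiv C p : RingAut C) ^ n) z) ^ m

/-- `z ^ e` for `e ∈ E`. By `fracPow_eq` below it does not depend on the way in which `e` is
written as `m p ^ n`. -/
noncomputable def fracPow (z : C) (e : Exponents p) : C :=
  monomialPow p z e.2.choose e.2.choose_spec.choose

theorem frobenius_zpow_natCast (z : C) (j : ℕ) :
    ((frobeniusEquiv C p : RingAut C) ^ (j : ℤ)) z = z ^ p ^ j := by
  rw [zpow_natCast]
  induction j with
  | zero => simp
  | succ j ih =>
    rw [pow_succ', RingAut.mul_apply, ih]
    simp [frobeniusEquiv_apply, frobenius_def, pow_succ, pow_mul]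

theorem monomialPow_shift (z : C) (m : ℕ) (n : ℤ) (j : ℕ) :
    monomialPow p z m (n + j) = monomialPow p z (m * p ^ j) n := by
  unfold monomialPow
  rw [add_comm, zpow_add, RingAut.mul_apply, frobenius_zpow_natCast, ← pow_mul, mul_comm]

theorem monomialPow_congr (z : C) {m m' : ℕ} {n n' : ℤ}
    (h : (m : ℚ) * (p : ℚ) ^ n = m' * (p : ℚ) ^ n') :
    monomialPow p z m n = monomialPow p z m' n' := by
  have hp : (p : ℚ) ≠ 0 := by exact_mod_cast (Fact.out : p.Prime).ne_zero
  wlog hn : n ≤ n' generalizing m m' n n'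
  · exact (this h.symm (le_of_not_ge hn)).symm
  obtain ⟨j, rfl⟩ := Int.le.dest hn
  rw [zpow_add₀ hp, zpow_natCast] at h
  have h2 : (m : ℚ) = m' * (p : ℚ) ^ j := by
    have := zpow_ne_zero n hp
    apply mul_right_cancel₀ this
    rw [h]; ring
  have h3 : m = m' * p ^ j := by exact_mod_cast h2
  rw [monomialPow_shift, h3]

theorem fracPow_eq (z : C) (e : Exponents p) (m : ℕ) (n : ℤ) (h : (e : ℚ) = m * (p : ℚ) ^ n) :
    fracPow p z e = (((frobeniusEquiv C p : RingAut C) ^ n) z) ^ m :=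
  monomialPow_congr p z (e.2.choose_spec.choose_spec.symm.trans h)

variable (C) in
/-- The set `𝓟` of fractional power series `∑_{e ∈ E} a_e z ^ e` that converge at every `z ∈ C`:
for every `r > 0` only finitely many terms have absolute value greater than `r`. -/
structure FracPowerSeries where
  /-- the coefficients `a_e` -/
  coeff : Exponents p → C
  converges : ∀ z : C, ∀ r : ℝ, 0 < r → {e | r < ‖coeff e * fracPow p z e‖}.Finite

namespace FracPowerSeries

variable {p}

/-- The value `f(z)`. -/
noncomputable def eval (f : FracPowerSeries C p) (z : C) : C :=
  ∑' e, f.coeff e * fracPow p z e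

/-- The sum in the definition of `eval` is never a junk value. -/
theorem hasSum_eval [IsUltrametricDist C] [CompleteSpace C] (f : FracPowerSeries C p) (z : C) :
    HasSum (fun e => f.coeff e * fracPow p z e) (f.eval z) := by
  refine Summable.hasSum (NonarchimedeanAddGroup.summable_of_tendsto_cofinite_zero ?_)
  rw [Metric.tendsto_nhds]
  intro ε hε
  rw [Filter.eventually_cofinite]
  refine (f.converges z (ε / 2) (by positivity)).subset fun e he => ?_
  simp only [dist_zero_right, not_lt, Set.mem_ofPred_eq] at he ⊢
  linarith

/-- `f` is a constant series: all coefficients of `z ^ e`, `e ≠ 0`, vanish. -/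
def IsConstant (f : FracPowerSeries C p) : Prop :=
  ∀ e : Exponents p, (e : ℚ) ≠ 0 → f.coeff e = 0

end FracPowerSeries

end Field

/-- The exponent `q ^ n` as an element of `E`, where `q = p ^ k`. -/
def qExponent (p k : ℕ) (n : ℤ) : Exponents p :=
  ⟨((p ^ k : ℕ) : ℚ) ^ n, 1, k * n, by rw [zpow_mul]; simp⟩

/-- The set `𝓕 ⊆ 𝓟` of bi-infinite series `∑_{n ∈ ℤ} a_n z ^ (q ^ n)`, where `q = p ^ k`. -/
def LinearSeries (C : Type*) [NormedField C] [IsAlgClosed C] (p : ℕ) [Fact p.Prime] [CharP C p]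
    (k : ℕ) : Set (FracPowerSeries C p) :=
  {f | ∀ e, f.coeff e ≠ 0 → ∃ n : ℤ, e = qExponent p k n}

section ClassG

variable {C : Type*} [NormedField C]

open Classical in
/-- The valuation `v(z) = -log |z|`, with `v(0) = +∞`. -/
noncomputable def val (z : C) : EReal := if z = 0 then ⊤ else ((-Real.log ‖z‖ : ℝ) : EReal)

/-- `∫_H v = +∞` with respect to any Haar measure on the additive group `H`: the integral of the
positive part of `v` is infinite, and that of the negative part is finite. -/
def HaarIntegralValEqTop (H : AddSubgroup C) : Prop :=
  letI : MeasurableSpace H := borel H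
  ∀ μ : Measure H, μ.IsAddHaarMeasure →
    ∫⁻ x, (val (x : C)).toENNReal ∂μ = ⊤ ∧ ∫⁻ x, (-val (x : C)).toENNReal ∂μ ≠ ⊤

variable [IsUltrametricDist C] {F : Type*} [Field F] [Algebra F C]

/-- The additive group `G ∩ Δ_r`, where `Δ_r = {x : |x| ≤ r}`. -/
def interBall (G : Submodule F C) (r : ℝ) (hr : 0 < r) : AddSubgroup C where
  carrier := {x | x ∈ G ∧ ‖x‖ ≤ r}
  zero_mem' := ⟨G.zero_mem, by simpa using hr.le⟩
  add_mem' := fun {x y} hx hy => ⟨G.add_mem hx.1 hy.1,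
    (IsUltrametricDist.norm_add_le_max x y).trans (max_le hx.2 hy.2)⟩
  neg_mem' := fun {x} hx => ⟨G.neg_mem hx.1, by simpa using hx.2⟩

/-- The class `𝓖` of sub-`F`-vector spaces `G` of `C`, as defined by means of the radius `r`. -/
structure MemClassG (r : ℝ) (hr : 0 < r) (G : Submodule F C) : Prop where
  isCompact : IsCompact (interBall G r hr : Set C)
  integral_val : HaarIntegralValEqTop (interBall G r hr)
  countable_index :
    Countable (G.toAddSubgroup ⧸ (interBall G r hr).addSubgroupOf G.toAddSubgroup)
  /-- If `G ∩ Δ_r` has countably infinite index in `G`, then the members of any system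
  `g 0, g 1, …` of coset representatives tend to infinity. -/
  tendsto_norm : ∀ g : ℕ → G.toAddSubgroup,
    Function.Bijective (fun n => (QuotientAddGroup.mk (g n) :
      G.toAddSubgroup ⧸ (interBall G r hr).addSubgroupOf G.toAddSubgroup)) →
    Tendsto (fun n => ‖(g n : C)‖) atTop atTop

end ClassG

end FracSeries

/-! On a disk of radius `R`, a series `f` is within `ε` of the finite sum of its terms of Gauss norm
greater than `ε`, and by additivity of Frobenius some `p ^ N`-th power of that sum is an ordinary
polynomial `Q`. Its Gauss norm at `S ≤ R` is `f.gauss S ^ p ^ N` when `ε < f.gauss S`, and also, by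
factorisation over `C`, the leading norm times the product of `max S ‖a‖` over the roots `a`. With
truncation at radius `2 * R`, the growth from `R` to `2 * R` bounds the number of roots in the disk
of radius `R` by `f.kappa R * p ^ N`. After taking `p ^ N`-th roots neither `N` nor `ε` is left: if
the truncation is smaller than `f.gauss R * t ^ f.kappa R` at `z`, it has a zero within `t * R` of
`z` (`exists_trunc_eq_zero`).

Refining the truncation and using completeness gives the same for `f` (`exists_eval_eq_zero`). Zeros
of `f` and of its truncations thus approximate each other, so the zeros of `f` in a disk form a
closed, totally bounded set (`isCompact_zeros_inter_ball`). Local compactness of fibers and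
conditions (1) and (3) for kernels follow.

On an annulus without zeros the Gauss norm is a constant times `S ^ d` (`gauss_mul_rpow_kappa_eq`).
If all zeros are bounded, this holds for all large `S` and `d` is the largest exponent; if a disk
contains no nonzero zero, it holds for all small `S` and `d` is the least exponent. Conversely, a
term of extreme exponent dominates for large or small `z`.

For linear `f` the polynomial `Q` is additive, so its roots are equally distributed among the
`δ`-disks that meet them (`countP_roots_disk_eq`). Jensen's formula for `Q` then shows that `f.kappa
r` times the mean of `log (r / max δ ‖x‖)` over the zeros in the disk of radius `r` is at least `log
(f.gauss r) - log (f.gauss δ)`. This is unbounded as `δ` tends to `0`, which forces the integral of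
`v` to diverge. -/

namespace FracSeries

open Polynomial

/-! ### Products over a multiset of roots -/

section Multiset

variable {C : Type*} [NormedField C] (s : Multiset C)

/-- Roots outside the disk satisfy `‖z - a‖ = ‖a‖`; each root inside costs at most a factor `t`. -/
theorem prod_max_mul_pow_le_prod_norm_sub [IsUltrametricDist C] {R t : ℝ} {z : C} (ht0 : 0 ≤ t)
    (hR : 0 < R) (hz : ‖z‖ ≤ R) (h : ∀ a ∈ s, t * R ≤ ‖z - a‖) :
    (s.map fun a => max R ‖a‖).prod * t ^ s.countP (fun a => ‖a‖ ≤ R)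
      ≤ (s.map fun a => ‖z - a‖).prod := by
  induction s using Multiset.induction_on with
  | empty => simp
  | cons a s ih =>
    have ih := ih fun b hb => h b (Multiset.mem_cons_of_mem hb)
    have ha := h a (Multiset.mem_cons_self a s)
    have hpos : 0 ≤ (s.map fun a => max R ‖a‖).prod :=
      Multiset.prod_nonneg fun x hx => by
        obtain ⟨b, -, rfl⟩ := Multiset.mem_map.1 hx
        positivity
    simp only [Multiset.map_cons, Multiset.prod_cons]
    by_cases haR : ‖a‖ ≤ R
    · rw [Multiset.countP_cons_of_pos (p := fun b : C => ‖b‖ ≤ R) s haR, max_eq_left haR, pow_succ]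
      calc R * (s.map fun a => max R ‖a‖).prod * (t ^ s.countP (fun a => ‖a‖ ≤ R) * t)
          = (t * R) * ((s.map fun a => max R ‖a‖).prod * t ^ s.countP (fun a => ‖a‖ ≤ R)) := by ring
        _ ≤ _ := by gcongr
    · rw [Multiset.countP_cons_of_neg (p := fun b : C => ‖b‖ ≤ R) s haR, max_eq_right (not_le.1 haR).le, mul_assoc]
      have : ‖z - a‖ = ‖a‖ := by
        have hne : ‖z‖ ≠ ‖-a‖ := by rw [norm_neg]; intro h; exact haR (h ▸ hz)
        rw [sub_eq_add_neg, IsUltrametricDist.norm_add_eq_max_of_norm_ne_norm hne, norm_neg]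
        exact max_eq_right (hz.trans (not_le.1 haR).le)
      rw [this]
      gcongr

theorem prod_max_pos {R : ℝ} (hR : 0 < R) : 0 < (s.map fun a => max R ‖a‖).prod :=
  Multiset.prod_pos fun x hx => by
    obtain ⟨b, -, rfl⟩ := Multiset.mem_map.1 hx
    positivity

theorem prod_max_mul_pow_le_prod_max {R S : ℝ} (hR : 0 < R) (hRS : R ≤ S) :
    (s.map fun a => max R ‖a‖).prod * (S / R) ^ s.countP (fun a => ‖a‖ ≤ R)
      ≤ (s.map fun a => max S ‖a‖).prod := by
  induction s using Multiset.induction_on with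
  | empty => simp
  | cons a s ih =>
    have hpos := (prod_max_pos s hR).le
    simp only [Multiset.map_cons, Multiset.prod_cons]
    by_cases haR : ‖a‖ ≤ R
    · rw [Multiset.countP_cons_of_pos (p := fun b : C => ‖b‖ ≤ R) s haR, max_eq_left haR, pow_succ]
      calc R * (s.map fun a => max R ‖a‖).prod * ((S / R) ^ s.countP (fun a => ‖a‖ ≤ R) * (S / R))
          = S * ((s.map fun a => max R ‖a‖).prod * (S / R) ^ s.countP (fun a => ‖a‖ ≤ R)) := by
            field_simp
        _ ≤ _ := by
          have : 0 ≤ S / R := div_nonneg (hR.le.trans hRS) hR.le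
          gcongr
          exact le_max_left S ‖a‖
    · rw [Multiset.countP_cons_of_neg (p := fun b : C => ‖b‖ ≤ R) s haR, mul_assoc]
      have : 0 ≤ S / R := div_nonneg (hR.le.trans hRS) hR.le
      gcongr

theorem prod_max_mul_pow_eq {R₀ R S : ℝ} (hS : R₀ ≤ S) (hSR : S ≤ R)
    (h : ∀ a ∈ s, ‖a‖ ≤ R → ‖a‖ ≤ R₀) :
    (s.map fun a => max S ‖a‖).prod * R₀ ^ s.countP (fun a => ‖a‖ ≤ R)
      = (s.map fun a => max R₀ ‖a‖).prod * S ^ s.countP (fun a => ‖a‖ ≤ R) := by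
  induction s using Multiset.induction_on with
  | empty => simp
  | cons a s ih =>
    have ih := ih fun b hb => h b (Multiset.mem_cons_of_mem hb)
    simp only [Multiset.map_cons, Multiset.prod_cons]
    by_cases haR : ‖a‖ ≤ R
    · have h0 := h a (Multiset.mem_cons_self a s) haR
      rw [Multiset.countP_cons_of_pos (p := fun b : C => ‖b‖ ≤ R) s haR, max_eq_left h0, max_eq_left (h0.trans hS), pow_succ,
        pow_succ]
      linear_combination (S * R₀) * ih
    · have h1 := (not_le.1 haR).le
      rw [Multiset.countP_cons_of_neg (p := fun b : C => ‖b‖ ≤ R) s haR, max_eq_right ((hS.trans hSR).trans h1),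
        max_eq_right (hSR.trans h1)]
      linear_combination ‖a‖ * ih

/-- Jensen's formula before taking logarithms: between radii `δ` and `R` only the roots of norm at
most `R` change their factor, from `max δ ‖a‖` to `R`. -/
theorem prod_max_mul_prod_filter_eq {δ R : ℝ} (hδR : δ ≤ R) :
    (s.map fun a => max R ‖a‖).prod * ((s.filter fun a => ‖a‖ ≤ R).map fun a => max δ ‖a‖).prod
      = (s.map fun a => max δ ‖a‖).prod * R ^ s.countP (fun a => ‖a‖ ≤ R) := by
  induction s using Multiset.induction_on with
  | empty => simp
  | cons a s ih =>
    simp only [Multiset.map_cons, Multiset.prod_cons]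
    by_cases haR : ‖a‖ ≤ R
    · rw [Multiset.countP_cons_of_pos (p := fun b : C => ‖b‖ ≤ R) s haR, Multiset.filter_cons_of_pos (p := fun b : C => ‖b‖ ≤ R) s haR, max_eq_left haR,
        pow_succ, Multiset.map_cons, Multiset.prod_cons]
      linear_combination (R * max δ ‖a‖) * ih
    · have h1 := (not_le.1 haR).le
      rw [Multiset.countP_cons_of_neg (p := fun b : C => ‖b‖ ≤ R) s haR, Multiset.filter_cons_of_neg (p := fun b : C => ‖b‖ ≤ R) s haR,
        max_eq_right (hδR.trans h1), max_eq_right h1]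
      linear_combination ‖a‖ * ih

end Multiset

/-! ### Gauss norms and roots of polynomials -/

section Polynomial

variable {C : Type*} [NormedField C] [IsAlgClosed C]

/-- The Gauss norm of a polynomial with radius `R`. -/
noncomputable def polyGauss (R : ℝ) (Q : C[X]) : ℝ :=
  Q.gaussNorm (NormedField.toAbsoluteValue C) R

theorem norm_eval_eq_prod (Q : C[X]) (z : C) :
    ‖Q.eval z‖ = ‖Q.leadingCoeff‖ * (Q.roots.map fun a => ‖z - a‖).prod := by
  conv_lhs => rw [(IsAlgClosed.splits Q).eq_prod_roots]
  rw [eval_mul, eval_C, norm_mul, eval_multiset_prod, Multiset.map_map]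
  congr 1
  generalize Q.roots = s
  induction s using Multiset.induction_on with
  | empty => simp
  | cons a s ih =>
    simp only [Multiset.map_cons, Multiset.prod_cons, norm_mul, ih]
    simp

variable [IsUltrametricDist C]

omit [IsAlgClosed C] in
theorem polyGauss_mul {R : ℝ} (hR : 0 < R) (P Q : C[X]) :
    polyGauss R (P * Q) = polyGauss R P * polyGauss R Q :=
  gaussNorm_mul (v := NormedField.toAbsoluteValue C)
    (IsUltrametricDist.isNonarchimedean_norm (R := C)) hR P Q

omit [IsAlgClosed C] [IsUltrametricDist C] in
theorem polyGauss_X_sub_C {R : ℝ} (hR : 0 < R) (a : C) : polyGauss R (X - Polynomial.C a) = max R ‖a‖ := by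
  apply le_antisymm
  · obtain ⟨i, hi⟩ := exists_eq_gaussNorm (NormedField.toAbsoluteValue C) R (X - Polynomial.C a)
    rw [polyGauss, hi]
    rcases i with _ | _ | i
    · simp [NormedField.toAbsoluteValue]
    · simp [NormedField.toAbsoluteValue]
    · simp [NormedField.toAbsoluteValue, coeff_X, hR.le]
  · have h0 := le_gaussNorm (NormedField.toAbsoluteValue C) (X - Polynomial.C a) hR.le 0
    have h1 := le_gaussNorm (NormedField.toAbsoluteValue C) (X - Polynomial.C a) hR.le 1
    simp [NormedField.toAbsoluteValue, coeff_C] at h0 h1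
    exact max_le h1 h0

theorem polyGauss_eq_prod {R : ℝ} (hR : 0 < R) (Q : C[X]) :
    polyGauss R Q = ‖Q.leadingCoeff‖ * (Q.roots.map fun a => max R ‖a‖).prod := by
  conv_lhs => rw [(IsAlgClosed.splits Q).eq_prod_roots]
  rw [polyGauss_mul hR]
  congr 1
  · exact gaussNorm_C _ _ _
  generalize Q.roots = s
  induction s using Multiset.induction_on with
  | empty => simpa [NormedField.toAbsoluteValue, polyGauss] using
      gaussNorm_C (NormedField.toAbsoluteValue C) R (1 : C)
  | cons a s ih =>
    simp only [Multiset.map_cons, Multiset.prod_cons, polyGauss_mul hR, ih, polyGauss_X_sub_C hR]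

/-- The number of roots of `Q` in the disk of radius `R`, with multiplicities. -/
noncomputable def rootCount (R : ℝ) (Q : C[X]) : ℕ := Q.roots.countP fun a => ‖a‖ ≤ R

theorem polyGauss_mul_pow_le_norm_eval {Q : C[X]} {R t : ℝ} {z : C} (ht0 : 0 ≤ t)
    (hR : 0 < R) (hz : ‖z‖ ≤ R) (h : ∀ a ∈ Q.roots, t * R ≤ ‖z - a‖) :
    polyGauss R Q * t ^ rootCount R Q ≤ ‖Q.eval z‖ := by
  rw [polyGauss_eq_prod hR, norm_eval_eq_prod, mul_assoc]
  gcongr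
  exact prod_max_mul_pow_le_prod_norm_sub _ ht0 hR hz h

theorem polyGauss_mul_pow_le_polyGauss (Q : C[X]) {R S : ℝ} (hR : 0 < R) (hRS : R ≤ S) :
    polyGauss R Q * (S / R) ^ rootCount R Q ≤ polyGauss S Q := by
  rw [polyGauss_eq_prod hR, polyGauss_eq_prod (hR.trans_le hRS), mul_assoc]
  gcongr
  exact prod_max_mul_pow_le_prod_max _ hR hRS

theorem polyGauss_mul_pow_eq {Q : C[X]} {R₀ R S : ℝ} (hR₀ : 0 < R₀) (hS : R₀ ≤ S) (hSR : S ≤ R)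
    (h : ∀ a ∈ Q.roots, ‖a‖ ≤ R → ‖a‖ ≤ R₀) :
    polyGauss S Q * R₀ ^ rootCount R Q = polyGauss R₀ Q * S ^ rootCount R Q := by
  rw [polyGauss_eq_prod hR₀, polyGauss_eq_prod (hR₀.trans_le hS), mul_assoc, mul_assoc]
  congr 1
  exact prod_max_mul_pow_eq _ hS hSR h

theorem polyGauss_mul_prod_filter_eq (Q : C[X]) {δ R : ℝ} (hδ : 0 < δ) (hδR : δ ≤ R) :
    polyGauss R Q * ((Q.roots.filter fun a => ‖a‖ ≤ R).map fun a => max δ ‖a‖).prod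
      = polyGauss δ Q * R ^ rootCount R Q := by
  rw [polyGauss_eq_prod hδ, polyGauss_eq_prod (hδ.trans_le hδR), mul_assoc, mul_assoc]
  congr 1
  exact prod_max_mul_prod_filter_eq _ hδR

/-- The roots of an additive polynomial are equally distributed over the disks of a given radius
that contain a root. -/
theorem countP_roots_disk_eq {Q : C[X]} (hQ : ∀ x y, Q.eval (x + y) = Q.eval x + Q.eval y)
    {δ : ℝ} {t b : C} (hb : Q.eval b = 0) (hbt : ‖b - t‖ ≤ δ) :
    Q.roots.countP (fun x => ‖x - t‖ ≤ δ) = rootCount δ Q := by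
  have : Infinite C := IsAlgClosed.instInfinite
  -- Translation by the root `b` leaves an additive polynomial unchanged, so it permutes the roots
  -- with their multiplicities.
  have hcomp : Q.comp (Polynomial.C 1 * X + Polynomial.C b) = Q := by
    refine Polynomial.funext fun x => ?_
    simp [hQ, hb]
  have hroots := map_roots_comp_C_mul_X_add_C Q 1 b isUnit_one
  rw [hcomp] at hroots
  conv_lhs => rw [← hroots]
  rw [Multiset.countP_map, rootCount, Multiset.countP_eq_card_filter]
  congr 1
  refine Multiset.filter_congr fun x _ => ?_
  rw [one_mul, add_sub_assoc]
  constructor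
  · intro h
    have := IsUltrametricDist.norm_add_le_max (x + (b - t)) (t - b)
    rw [add_assoc, sub_add_sub_cancel, sub_self, add_zero, norm_sub_rev t b] at this
    exact this.trans (max_le h hbt)
  · intro h
    exact (IsUltrametricDist.norm_add_le_max _ _).trans (max_le h hbt)

end Polynomial

end FracSeries

namespace FracSeries

/-! ### Gauss norms and truncations of fractional power series -/

section Series

variable {C : Type*} [NormedField C] [IsAlgClosed C] {p : ℕ} [Fact p.Prime] [CharP C p]

omit [Fact p.Prime] in
theorem exponents_nonneg (e : Exponents p) : (0 : ℝ) ≤ ((e : ℚ) : ℝ) := by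
  obtain ⟨m, n, h⟩ := e.2
  rw [h]
  positivity

theorem norm_frobenius_zpow (z : C) (n : ℤ) :
    ‖((frobeniusEquiv C p : RingAut C) ^ n) z‖ = ‖z‖ ^ ((p : ℝ) ^ n) := by
  have hp : (p : ℝ) ≠ 0 := by exact_mod_cast (Fact.out : p.Prime).ne_zero
  obtain ⟨j, rfl | rfl⟩ := n.eq_nat_or_neg
  · rw [frobenius_zpow_natCast, norm_pow, zpow_natCast, ← Real.rpow_natCast]
    push_cast
    rfl
  · set w := ((frobeniusEquiv C p : RingAut C) ^ (-(j : ℤ))) z with hw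
    have h : z = w ^ p ^ j := by
      rw [← frobenius_zpow_natCast p, hw, ← RingAut.mul_apply, ← zpow_add]
      simp
    rw [h, norm_pow, ← Real.rpow_natCast, ← Real.rpow_mul (norm_nonneg _)]
    simp [hp]

theorem norm_fracPow (z : C) (e : Exponents p) :
    ‖fracPow p z e‖ = ‖z‖ ^ ((e : ℚ) : ℝ) := by
  obtain ⟨m, n, h⟩ := e.2
  rw [fracPow_eq p z e m n h, norm_pow, norm_frobenius_zpow, ← Real.rpow_natCast,
    ← Real.rpow_mul (norm_nonneg _), h]
  push_cast
  rw [mul_comm]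

theorem continuous_frobenius_zpow (n : ℤ) :
    Continuous fun z : C => ((frobeniusEquiv C p : RingAut C) ^ n) z := by
  have hp : (0 : ℝ) < p := by exact_mod_cast (Fact.out : p.Prime).pos
  refine continuous_of_continuousAt_zero ((frobeniusEquiv C p : RingAut C) ^ n : C ≃+* C) ?_
  have h0 : ((frobeniusEquiv C p : RingAut C) ^ n : C ≃+* C) 0 = 0 := map_zero _
  rw [ContinuousAt, h0, tendsto_zero_iff_norm_tendsto_zero]
  have : Tendsto (fun z : C => ‖z‖ ^ ((p : ℝ) ^ n)) (𝓝 0) (𝓝 (‖(0 : C)‖ ^ ((p : ℝ) ^ n))) :=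
    (continuous_norm.rpow_const fun _ => Or.inr (by positivity)).tendsto 0
  rw [norm_zero, Real.zero_rpow (by positivity)] at this
  exact this.congr fun z => (norm_frobenius_zpow z n).symm

theorem continuous_fracPow (e : Exponents p) : Continuous fun z : C => fracPow p z e :=
  (continuous_frobenius_zpow _).pow _

namespace FracPowerSeries

variable (f : FracPowerSeries C p)

theorem finite_lt_norm_coeff_mul_rpow {R ε : ℝ} (hR : 0 < R) (hε : 0 < ε) :
    {e | ε < ‖f.coeff e‖ * R ^ ((e : ℚ) : ℝ)}.Finite := by
  by_cases hz : ∃ z : C, R ≤ ‖z‖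
  · obtain ⟨z, hz⟩ := hz
    refine (f.converges z ε hε).subset fun e he => ?_
    simp only [Set.mem_ofPred_eq, norm_mul, norm_fracPow] at he ⊢
    refine he.trans_le ?_
    gcongr
    exact exponents_nonneg e
  -- A bounded norm on a field is trivial: nonzero elements have norm at least `1` because their
  -- inverses have norm at most `1`. Convergence at `1` then leaves finitely many nonzero
  -- coefficients.
  · push Not at hz
    have hle : ∀ z : C, ‖z‖ ≤ 1 := by
      intro z
      by_contra! h
      obtain ⟨n, hn⟩ := pow_unbounded_of_one_lt R h
      have := hz (z ^ n)
      rw [norm_pow] at this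
      linarith
    refine (f.converges 1 (1 / 2) (by norm_num)).subset fun e he => ?_
    simp only [Set.mem_ofPred_eq, norm_mul, norm_fracPow, norm_one, Real.one_rpow, mul_one] at he ⊢
    have h0 : f.coeff e ≠ 0 := by
      intro h
      rw [h, norm_zero, zero_mul] at he
      linarith
    have h1 := hle (f.coeff e)⁻¹
    rw [norm_inv] at h1
    have h2 := (inv_le_one₀ (norm_pos_iff.2 h0)).1 h1
    linarith

/-- The Gauss norm `sup |a_e| R ^ e`. -/
noncomputable def gauss (R : ℝ) : ℝ := ⨆ e, ‖f.coeff e‖ * R ^ ((e : ℚ) : ℝ)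

theorem exists_isGreatest {R : ℝ} (hR : 0 < R) :
    ∃ e₀, ∀ e : Exponents p,
      ‖f.coeff e‖ * R ^ ((e : ℚ) : ℝ) ≤ ‖f.coeff e₀‖ * R ^ ((e₀ : ℚ) : ℝ) := by
  by_cases h : ∃ e, 0 < ‖f.coeff e‖ * R ^ ((e : ℚ) : ℝ)
  · obtain ⟨e₁, h₁⟩ := h
    obtain ⟨e₀, h₀, hmax⟩ := Set.exists_max_image _ (fun e => ‖f.coeff e‖ * R ^ ((e : ℚ) : ℝ))
      (f.finite_lt_norm_coeff_mul_rpow hR (half_pos h₁)) ⟨e₁, half_lt_self h₁⟩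
    refine ⟨e₀, fun e => ?_⟩
    by_cases he : e ∈ {e | ‖f.coeff e₁‖ * R ^ ((e₁ : ℚ) : ℝ) / 2 < ‖f.coeff e‖ * R ^ ((e : ℚ) : ℝ)}
    · exact hmax e he
    · exact (not_lt.1 he).trans (le_of_lt h₀)
  · push Not at h
    exact ⟨⟨0, 0, 0, by simp⟩, fun e => (h e).trans (by positivity)⟩

theorem le_gauss {R : ℝ} (hR : 0 < R) (e : Exponents p) :
    ‖f.coeff e‖ * R ^ ((e : ℚ) : ℝ) ≤ f.gauss R := by
  obtain ⟨e₀, h⟩ := f.exists_isGreatest hR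
  exact le_ciSup (f := fun e : Exponents p => ‖f.coeff e‖ * R ^ ((e : ℚ) : ℝ))
    ⟨_, by rintro _ ⟨e, rfl⟩; exact h e⟩ e

theorem exists_eq_gauss {R : ℝ} (hR : 0 < R) :
    ∃ e : Exponents p, f.gauss R = ‖f.coeff e‖ * R ^ ((e : ℚ) : ℝ) := by
  obtain ⟨e₀, h⟩ := f.exists_isGreatest hR
  have : Nonempty (Exponents p) := ⟨e₀⟩
  exact ⟨e₀, le_antisymm (ciSup_le h) (f.le_gauss hR e₀)⟩

variable {f} in
theorem gauss_pos (hf : f.coeff ≠ 0) {R : ℝ} (hR : 0 < R) : 0 < f.gauss R := by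
  obtain ⟨e, he⟩ := Function.ne_iff.1 hf
  refine lt_of_lt_of_le ?_ (f.le_gauss hR e)
  have : 0 < ‖f.coeff e‖ := norm_pos_iff.2 he
  positivity

theorem gauss_mono {R S : ℝ} (hR : 0 < R) (h : R ≤ S) : f.gauss R ≤ f.gauss S := by
  obtain ⟨e, he⟩ := f.exists_eq_gauss hR
  rw [he]
  refine le_trans ?_ (f.le_gauss (hR.trans_le h) e)
  gcongr
  exact exponents_nonneg e

/-- The finite set of exponents of the terms of Gauss norm greater than `ε`. -/
noncomputable def mainExponents {R ε : ℝ} (hR : 0 < R) (hε : 0 < ε) : Finset (Exponents p) :=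
  (f.finite_lt_norm_coeff_mul_rpow hR hε).toFinset

/-- The sum of the terms of Gauss norm greater than `ε`. -/
noncomputable def trunc {R ε : ℝ} (hR : 0 < R) (hε : 0 < ε) (z : C) : C :=
  ∑ e ∈ f.mainExponents hR hε, f.coeff e * fracPow p z e

theorem mem_mainExponents {R ε : ℝ} {hR : 0 < R} {hε : 0 < ε} {e : Exponents p} :
    e ∈ f.mainExponents hR hε ↔ ε < ‖f.coeff e‖ * R ^ ((e : ℚ) : ℝ) := by
  simp [mainExponents]

theorem norm_eval_sub_trunc_le [IsUltrametricDist C] [CompleteSpace C] {R ε : ℝ} (hR : 0 < R)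
    (hε : 0 < ε) {z : C} (hz : ‖z‖ ≤ R) : ‖f.eval z - f.trunc hR hε z‖ ≤ ε := by
  refine le_of_tendsto (((f.hasSum_eval z).sub_const (f.trunc hR hε z)).norm) ?_
  filter_upwards [eventually_ge_atTop (f.mainExponents hR hε)] with s hs
  rw [trunc, ← Finset.sum_sdiff hs, add_sub_cancel_right]
  refine IsUltrametricDist.norm_sum_le_of_forall_le_of_nonneg hε.le fun e he => ?_
  have h2 := (Finset.mem_sdiff.1 he).2
  rw [mem_mainExponents, not_lt] at h2
  rw [norm_mul, norm_fracPow]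
  refine le_trans ?_ h2
  gcongr
  exact exponents_nonneg e

theorem continuous_trunc {R ε : ℝ} (hR : 0 < R) (hε : 0 < ε) : Continuous (f.trunc hR hε) :=
  continuous_finsetSum _ fun e _ => continuous_const.mul (continuous_fracPow e)

theorem continuous_eval [IsUltrametricDist C] [CompleteSpace C] : Continuous f.eval := by
  rw [Metric.continuous_iff]
  intro z ε hε
  have hR : 0 < ‖z‖ + 1 := by positivity
  obtain ⟨δ, hδ, h⟩ := Metric.continuous_iff.1 (f.continuous_trunc hR (half_pos hε)) z ε hε
  refine ⟨min δ 1, by positivity, fun w hw => ?_⟩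
  have hw1 : ‖w‖ ≤ ‖z‖ + 1 := by
    have h1 := norm_le_norm_add_norm_sub' w z
    rw [dist_eq_norm] at hw
    linarith [hw.trans_le (min_le_right _ _)]
  have h1 := f.norm_eval_sub_trunc_le hR (half_pos hε) hw1
  have h2 := f.norm_eval_sub_trunc_le hR (half_pos hε) (z := z) (by linarith)
  have h3 := h w (hw.trans_le (min_le_left _ _))
  rw [← dist_eq_norm] at h1 h2
  rw [dist_comm] at h2
  refine (dist_triangle_max _ (f.trunc hR (half_pos hε) z) _).trans_lt (max_lt ?_ (by linarith))
  exact (dist_triangle_max _ (f.trunc hR (half_pos hε) w) _).trans_lt (max_lt (by linarith) h3)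

end FracPowerSeries

end Series

end FracSeries

namespace FracSeries

/-! ### Polynomial powers of truncations and the number of their zeros -/

section Series

variable {C : Type*} [NormedField C] [IsAlgClosed C] {p : ℕ} [Fact p.Prime] [CharP C p]

theorem exists_common_denominator (s : Finset (Exponents p)) :
    ∃ (N : ℕ) (m : Exponents p → ℕ), ∀ e ∈ s, (e : ℚ) = m e * (p : ℚ) ^ (-(N : ℤ)) := by
  have hp : (p : ℚ) ≠ 0 := by exact_mod_cast (Fact.out : p.Prime).ne_zero
  choose m n h using fun e : Exponents p => e.2
  obtain ⟨N, hN⟩ := (s.image fun e => (-n e).toNat).exists_le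
  refine ⟨N, fun e => m e * p ^ (n e + N).toNat, fun e he => ?_⟩
  have h1 : (-n e).toNat ≤ N := hN _ (Finset.mem_image_of_mem _ he)
  have h2 : ((n e + N).toNat : ℤ) = n e + N := Int.toNat_of_nonneg (by omega)
  rw [h e]
  push_cast
  rw [← zpow_natCast, h2, mul_assoc, ← zpow_add₀ hp]
  simp

namespace FracPowerSeries

variable (f : FracPowerSeries C p)

open Polynomial in
-- `p ^ N` is a common denominator of the finitely many exponents kept. The condition `ε < f.gauss
-- S` guarantees that the term attaining the Gauss norm at `S` survives the truncation at the larger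
-- radius `R`.
theorem exists_polynomial {R ε : ℝ} (hR : 0 < R) (hε : 0 < ε) :
    ∃ (N : ℕ) (Q : C[X]), (∀ z, Q.eval z = f.trunc hR hε z ^ p ^ N) ∧
      ∀ S, 0 < S → S ≤ R → ε < f.gauss S → polyGauss S Q = f.gauss S ^ p ^ N := by
  have hp : (p : ℚ) ≠ 0 := by exact_mod_cast (Fact.out : p.Prime).ne_zero
  have hpR : (p : ℝ) ≠ 0 := by exact_mod_cast (Fact.out : p.Prime).ne_zero
  set s := f.mainExponents hR hε with hs
  obtain ⟨N, m, hm⟩ := exists_common_denominator s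
  have hinj : Set.InjOn m s := by
    intro e he e' he' h
    exact Subtype.ext (by rw [hm e he, hm e' he', h])
  set Q : C[X] := ∑ e ∈ s, monomial (m e) (f.coeff e ^ p ^ N) with hQ
  have hcoeff : ∀ e ∈ s, Q.coeff (m e) = f.coeff e ^ p ^ N := by
    intro e he
    rw [hQ, finsetSum_coeff, Finset.sum_eq_single_of_mem e he]
    · simp
    · intro e' he' hne
      rw [coeff_monomial, if_neg fun h => hne (hinj he' he h)]
  have hcoeff0 : ∀ j, Q.coeff j ≠ 0 → ∃ e ∈ s, m e = j := by
    intro j hj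
    by_contra! h
    refine hj ?_
    rw [hQ, finsetSum_coeff]
    exact Finset.sum_eq_zero fun e he => by rw [coeff_monomial, if_neg (h e he)]
  have hterm : ∀ e ∈ s, ∀ S, 0 < S → ‖Q.coeff (m e)‖ * S ^ m e
      = (‖f.coeff e‖ * S ^ ((e : ℚ) : ℝ)) ^ p ^ N := by
    intro e he S hS
    rw [hcoeff e he, norm_pow, mul_pow]
    congr 1
    rw [← Real.rpow_natCast, ← Real.rpow_natCast (S ^ _), ← Real.rpow_mul hS.le, hm e he]
    congr 1
    push_cast
    rw [mul_assoc, ← zpow_natCast, ← zpow_add₀ hpR]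
    simp
  refine ⟨N, Q, fun z => ?_, fun S hS hSR hεS => ?_⟩
  · rw [trunc, sum_pow_char_pow, hQ, eval_finsetSum]
    refine Finset.sum_congr rfl fun e he => ?_
    rw [eval_monomial, mul_pow]
    congr 1
    rw [fracPow_eq p z e _ _ (hm e he), ← pow_mul, mul_comm, pow_mul, ← frobenius_zpow_natCast p,
      ← RingAut.mul_apply, ← zpow_add]
    simp
  · apply le_antisymm
    · obtain ⟨j, hj⟩ := exists_eq_gaussNorm (NormedField.toAbsoluteValue C) S Q
      rw [polyGauss, hj]
      by_cases h0 : Q.coeff j = 0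
      · rw [h0, map_zero, zero_mul]
        exact pow_nonneg (hε.trans hεS).le _
      · obtain ⟨e, he, rfl⟩ := hcoeff0 j h0
        refine (hterm e he S hS).trans_le ?_
        gcongr
        exact f.le_gauss hS e
    · obtain ⟨e, he⟩ := f.exists_eq_gauss hS
      have hes : e ∈ s := by
        rw [hs, mem_mainExponents]
        refine hεS.trans_le (he.trans_le ?_)
        gcongr
        exact exponents_nonneg e
      rw [he, ← hterm e hes S hS]
      exact le_gaussNorm (NormedField.toAbsoluteValue C) Q hS.le (m e)

omit [IsAlgClosed C] in
theorem ne_zero_of_polyGauss {Q : Polynomial C} {S : ℝ} (h : 0 < polyGauss S Q) : Q ≠ 0 := by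
  rintro rfl
  simp [polyGauss] at h

/-- A bound for the number of zeros of `f` in the disk of radius `R`. -/
noncomputable def kappa (R : ℝ) : ℝ := Real.logb 2 (f.gauss (2 * R) / f.gauss R)

variable [IsUltrametricDist C] {f} (hf : f.coeff ≠ 0) {R : ℝ} (hR : 0 < R)
include hf hR

/-- Each root in the disk of radius `R` contributes a factor `2` to the growth of the Gauss norm
from `R` to `2 * R`. -/
theorem rootCount_le {Q : Polynomial C} {N : ℕ} (h1 : polyGauss R Q = f.gauss R ^ p ^ N)
    (h2 : polyGauss (2 * R) Q = f.gauss (2 * R) ^ p ^ N) :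
    (rootCount R Q : ℝ) ≤ f.kappa R * p ^ N := by
  have h := polyGauss_mul_pow_le_polyGauss Q hR (by linarith : R ≤ 2 * R)
  have hg := gauss_pos hf hR
  have hg2 := gauss_pos hf (show 0 < 2 * R by positivity)
  rw [h1, h2, mul_div_cancel_right₀ _ hR.ne', mul_comm, ← le_div_iff₀ (by positivity), ← div_pow] at h
  have h3 := Real.logb_le_logb_of_le (b := 2) (by norm_num) (by positivity) h
  rw [Real.logb_pow, Real.logb_pow, Real.logb_self_eq_one (by norm_num)] at h3
  rw [kappa, mul_comm]
  push_cast at h3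
  linarith

omit [IsUltrametricDist C] in
theorem kappa_nonneg : 0 ≤ f.kappa R := by
  refine Real.logb_nonneg (by norm_num) ?_
  rw [one_le_div (gauss_pos hf hR)]
  exact f.gauss_mono hR (by linarith)

/-- If every root stayed at distance `t * R` from `z`, each root in the disk would cost at most a
factor `t`, and their number is at most `f.kappa R * p ^ N`. The threshold does not involve `ε`, so
the truncation can be refined freely. -/
theorem exists_trunc_eq_zero {ε : ℝ} (hε : 0 < ε) (hεR : ε < f.gauss R) {t : ℝ} (ht0 : 0 < t)
    (ht1 : t ≤ 1) {z : C} (hz : ‖z‖ ≤ R)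
    (h : ‖f.trunc (show 0 < 2 * R by positivity) hε z‖ < f.gauss R * t ^ f.kappa R) :
    ∃ a, f.trunc (show 0 < 2 * R by positivity) hε a = 0 ∧ ‖z - a‖ < t * R := by
  obtain ⟨N, Q, hQ, hg⟩ := f.exists_polynomial (show 0 < 2 * R by positivity) hε
  have hg1 := hg R hR (by linarith) hεR
  have hg2 := hg (2 * R) (by positivity) le_rfl (hεR.trans_le (f.gauss_mono hR (by linarith)))
  have hpN : p ^ N ≠ 0 := pow_ne_zero _ (Fact.out : p.Prime).ne_zero
  by_contra! hcon
  have hle := polyGauss_mul_pow_le_norm_eval (Q := Q) ht0.le hR hz fun a ha => hcon a (by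
    have := (Polynomial.mem_roots'.1 ha).2
    rw [Polynomial.IsRoot, hQ] at this
    exact eq_zero_of_pow_eq_zero this)
  rw [hQ, hg1, norm_pow] at hle
  have hpos := gauss_pos hf hR
  have h2 : ‖f.trunc (show 0 < 2 * R by positivity) hε z‖ ^ p ^ N
      < (f.gauss R * t ^ f.kappa R) ^ p ^ N := pow_lt_pow_left₀ h (norm_nonneg _) hpN
  refine absurd (h2.trans_le ?_) (not_lt.2 hle)
  rw [mul_pow]
  gcongr
  rw [← Real.rpow_natCast, ← Real.rpow_natCast, ← Real.rpow_mul ht0.le]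
  refine Real.rpow_le_rpow_of_exponent_ge ht0 ht1 ?_
  push_cast
  exact rootCount_le hf hR hg1 hg2

end FracPowerSeries

end Series

end FracSeries

namespace FracSeries

/-! ### Zeros of a series: existence, compactness, and the largest exponent -/

section Series

variable {C : Type*} [NormedField C] [IsAlgClosed C] {p : ℕ} [Fact p.Prime] [CharP C p]

namespace FracPowerSeries

variable [IsUltrametricDist C] [CompleteSpace C] {f : FracPowerSeries C p}

section

variable (hf : f.coeff ≠ 0) {R : ℝ} (hR : 0 < R)
include hf hR

omit [IsUltrametricDist C] [CompleteSpace C] in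
theorem finite_trunc_eq_zero {ε : ℝ} (hε : 0 < ε) (hεR : ε < f.gauss R) :
    {z | f.trunc hR hε z = 0}.Finite := by
  obtain ⟨N, Q, hQ, hg⟩ := f.exists_polynomial hR hε
  have hQ0 : Q ≠ 0 := ne_zero_of_polyGauss (S := R) (by
    rw [hg R hR le_rfl hεR]
    exact pow_pos (gauss_pos hf hR) _)
  refine (Polynomial.finite_setOfPred_isRoot hQ0).subset fun z hz => ?_
  simp only [Set.mem_ofPred_eq] at hz ⊢
  rw [Polynomial.IsRoot, hQ, hz, zero_pow (pow_ne_zero _ (Fact.out : p.Prime).ne_zero)]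

/-- A truncation with `ε < η` has a zero near `z`, and there `f` itself is at most `ε`. -/
theorem exists_norm_eval_lt {t : ℝ} (ht0 : 0 < t) (ht1 : t ≤ 1) {z : C} (hz : ‖z‖ ≤ R)
    (h : ‖f.eval z‖ < f.gauss R * t ^ f.kappa R) {η : ℝ} (hη : 0 < η) :
    ∃ a, ‖f.eval a‖ < η ∧ ‖z - a‖ < t * R := by
  have hM := gauss_pos hf hR
  have hMt : 0 < f.gauss R * t ^ f.kappa R := by positivity
  obtain ⟨ε, hε, hεlt⟩ := exists_between (lt_min hM (lt_min hMt hη))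
  obtain ⟨h1, h2, h3⟩ : ε < f.gauss R ∧ ε < f.gauss R * t ^ f.kappa R ∧ ε < η := by
    simpa only [lt_min_iff] using hεlt
  have hR2 : 0 < 2 * R := by positivity
  obtain ⟨a, ha, hza⟩ := exists_trunc_eq_zero hf hR hε h1 ht0 ht1 hz (by
    have := f.norm_eval_sub_trunc_le hR2 hε (z := z) (by linarith)
    have h4 : f.trunc hR2 hε z = f.eval z + -(f.eval z - f.trunc hR2 hε z) := by ring
    rw [h4]
    refine (IsUltrametricDist.norm_add_le_max _ _).trans_lt (max_lt h ?_)
    rw [norm_neg]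
    exact this.trans_lt h2)
  refine ⟨a, ?_, hza⟩
  have ha2 : ‖a‖ ≤ 2 * R := by
    have h5 : a = z + -(z - a) := by ring
    rw [h5]
    refine (IsUltrametricDist.norm_add_le_max _ _).trans (max_le (by linarith) ?_)
    rw [norm_neg]
    nlinarith
  have := f.norm_eval_sub_trunc_le hR2 hε ha2
  rw [ha, sub_zero] at this
  exact this.trans_lt h3

/-- Successive approximation: `exists_norm_eval_lt` is iterated with `t / 2 ^ n` in place of `t`, so
the steps decrease geometrically. -/
theorem exists_eval_eq_zero {t : ℝ} (ht0 : 0 < t) (ht1 : t ≤ 1) {z : C} (hz : ‖z‖ ≤ R)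
    (h : ‖f.eval z‖ < f.gauss R * t ^ f.kappa R) :
    ∃ a, f.eval a = 0 ∧ ‖z - a‖ ≤ t * R := by
  have hM := gauss_pos hf hR
  have htn : ∀ n : ℕ, 0 < t / 2 ^ n ∧ t / 2 ^ n ≤ t := fun n =>
    ⟨by positivity, div_le_self ht0.le (one_le_pow₀ (by norm_num))⟩
  let P : ℕ → C → Prop := fun n a =>
    ‖z - a‖ ≤ t * R ∧ ‖f.eval a‖ < f.gauss R * (t / 2 ^ n) ^ f.kappa R
  have step : ∀ n a, P n a → ∃ b, P (n + 1) b ∧ ‖a - b‖ ≤ t * R / 2 ^ n ∧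
      ‖f.eval b‖ < (1 / 2) ^ n := by
    rintro n a ⟨h1, h2⟩
    have ha : ‖a‖ ≤ R := by
      have h5 : a = z + -(z - a) := by ring
      rw [h5]
      refine (IsUltrametricDist.norm_add_le_max _ _).trans (max_le hz ?_)
      rw [norm_neg]
      nlinarith
    -- The first bound is the threshold required by the next step, the second makes the values of
    -- `f` tend to `0`.
    have hη : 0 < min (f.gauss R * (t / 2 ^ (n + 1)) ^ f.kappa R) ((1 / 2) ^ n) := by
      have := (htn (n + 1)).1
      positivity
    obtain ⟨b, hb, hab⟩ := exists_norm_eval_lt hf hR (htn n).1 ((htn n).2.trans ht1) ha h2 hη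
    have hab2 : t / 2 ^ n * R = t * R / 2 ^ n := by ring
    refine ⟨b, ⟨?_, hb.trans_le (min_le_left _ _)⟩, hab2 ▸ hab.le, hb.trans_le (min_le_right _ _)⟩
    rw [← sub_add_sub_cancel z a b]
    refine (IsUltrametricDist.norm_add_le_max _ _).trans (max_le h1 (hab.le.trans ?_))
    have := (htn n).2
    gcongr
  choose! next hnext using step
  let u : ℕ → C := fun n => Nat.rec z (fun n a => next n a) n
  have hu : ∀ n, P n (u n) := by
    intro n
    induction n with
    | zero => exact ⟨by
        change ‖z - z‖ ≤ _
        rw [sub_self, norm_zero]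
        positivity, by simpa [u] using h⟩
    | succ n ih => exact (hnext n _ ih).1
  have hcauchy : CauchySeq u := by
    refine cauchySeq_of_le_geometric (1 / 2) (t * R) (by norm_num) fun n => ?_
    rw [dist_eq_norm, one_div, inv_pow, ← div_eq_mul_inv]
    exact (hnext n _ (hu n)).2.1
  obtain ⟨a, ha⟩ := cauchySeq_tendsto_of_complete hcauchy
  refine ⟨a, ?_, ?_⟩
  · have h1 := (f.continuous_eval.tendsto a).comp ha
    have h2 : Tendsto (fun n => f.eval (u (n + 1))) atTop (𝓝 0) :=
      squeeze_zero_norm (fun n => (hnext n _ (hu n)).2.2.le)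
        (tendsto_pow_atTop_nhds_zero_of_lt_one (by norm_num) (by norm_num))
    exact tendsto_nhds_unique ((tendsto_add_atTop_iff_nat 1).2 h1) h2
  · exact le_of_tendsto (tendsto_const_nhds.sub ha).norm (Eventually.of_forall fun n => (hu n).1)

/-- Total boundedness: with `t * R < δ` and `ε` below the threshold for `t`, every zero of `f` in
the disk is within `δ` of one of the finitely many zeros of a single truncation. -/
theorem isCompact_zeros_inter_ball : IsCompact {z | f.eval z = 0 ∧ ‖z‖ ≤ R} := by
  rw [isCompact_iff_totallyBounded_isComplete]
  constructor
  · rw [Metric.totallyBounded_iff]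
    intro δ hδ
    have hM := gauss_pos hf hR
    obtain ⟨t, ht0, htlt⟩ := exists_between (lt_min one_pos (div_pos hδ hR))
    obtain ⟨ht1, ht2⟩ := lt_min_iff.1 htlt
    have hMt : 0 < f.gauss R * t ^ f.kappa R := by positivity
    obtain ⟨ε, hε, hεlt⟩ := exists_between (lt_min hM hMt)
    obtain ⟨h1, h2⟩ := lt_min_iff.1 hεlt
    have hR2 : 0 < 2 * R := by positivity
    refine ⟨_, finite_trunc_eq_zero hf hR2 hε (h1.trans_le (f.gauss_mono hR (by linarith))),
      fun z hz => ?_⟩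
    have h3 := f.norm_eval_sub_trunc_le hR2 hε (z := z) (by linarith [hz.2])
    rw [hz.1, zero_sub, norm_neg] at h3
    obtain ⟨a, ha, hza⟩ := exists_trunc_eq_zero hf hR hε h1 ht0 ht1.le hz.2 (h3.trans_lt h2)
    refine Set.mem_biUnion (x := a) ha ?_
    rw [Metric.mem_ball, dist_eq_norm]
    exact hza.trans ((lt_div_iff₀ hR).1 ht2)
  · refine IsClosed.isComplete ?_
    exact (isClosed_eq f.continuous_eval continuous_const).inter
      (isClosed_le continuous_norm continuous_const)

end

variable (hf : f.coeff ≠ 0)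
include hf

theorem exists_norm_sub_le_of_trunc_eq_zero {R t : ℝ} (hR : 0 < R) (ht0 : 0 < t) (ht1 : t ≤ 1)
    {ε : ℝ} (hε : 0 < ε) (h : ε < f.gauss R * t ^ f.kappa R) {a : C} (ha : ‖a‖ ≤ R)
    (ha0 : f.trunc (show 0 < 2 * R by positivity) hε a = 0) :
    ∃ b, f.eval b = 0 ∧ ‖a - b‖ ≤ t * R := by
  refine exists_eval_eq_zero hf hR ht0 ht1 ha (lt_of_le_of_lt ?_ h)
  have := f.norm_eval_sub_trunc_le (show 0 < 2 * R by positivity) hε (z := a) (by linarith)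
  rwa [ha0, sub_zero] at this

theorem exists_gauss_mul_rpow_eq {R₀ R : ℝ} (hR₀ : 0 < R₀) (hR₀R : R₀ ≤ R)
    (h : ∀ z, f.eval z = 0 → ‖z‖ ≤ R → ‖z‖ ≤ R₀) :
    ∃ d : ℝ, ∀ S, R₀ ≤ S → S ≤ R → f.gauss S * R₀ ^ d = f.gauss R₀ * S ^ d := by
  have hR : 0 < R := hR₀.trans_le hR₀R
  have hR2 : 0 < 2 * R := by positivity
  have hM₀ := gauss_pos hf hR₀
  have hM := gauss_pos hf hR
  -- With `t = R₀ / R` the distance `t * R` is `R₀`: each root of `Q` in the disk of radius `R` is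
  -- within `R₀` of a zero of `f`, hence has norm at most `R₀`.
  have ht0 : 0 < R₀ / R := by positivity
  have ht1 : R₀ / R ≤ 1 := (div_le_one hR).2 hR₀R
  have hMt : 0 < f.gauss R * (R₀ / R) ^ f.kappa R := by positivity
  obtain ⟨ε, hε, hεlt⟩ := exists_between (lt_min hM₀ hMt)
  obtain ⟨h1, h2⟩ := lt_min_iff.1 hεlt
  obtain ⟨N, Q, hQ, hg⟩ := f.exists_polynomial hR2 hε
  have hpN : (p ^ N : ℕ) ≠ 0 := pow_ne_zero _ (Fact.out : p.Prime).ne_zero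
  have hgS : ∀ S, R₀ ≤ S → S ≤ R → polyGauss S Q = f.gauss S ^ p ^ N := fun S hS hSR =>
    hg S (hR₀.trans_le hS) (by linarith) (h1.trans_le (f.gauss_mono hR₀ hS))
  have hroot : ∀ a ∈ Q.roots, ‖a‖ ≤ R → ‖a‖ ≤ R₀ := by
    intro a ha haR
    have ha0 := (Polynomial.mem_roots'.1 ha).2
    rw [Polynomial.IsRoot, hQ] at ha0
    obtain ⟨b, hb, hab⟩ := exists_norm_sub_le_of_trunc_eq_zero hf hR ht0 ht1 hε h2 haR
      (eq_zero_of_pow_eq_zero ha0)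
    rw [div_mul_cancel₀ _ hR.ne'] at hab
    have hbR : ‖b‖ ≤ R := by
      have h5 : b = a + -(a - b) := by ring
      rw [h5]
      refine (IsUltrametricDist.norm_add_le_max _ _).trans (max_le haR ?_)
      rw [norm_neg]
      exact hab.trans hR₀R
    rw [← sub_add_cancel a b]
    exact (IsUltrametricDist.norm_add_le_max _ _).trans (max_le hab (h b hb hbR))
  refine ⟨rootCount R Q / (p ^ N : ℕ), fun S hS hSR => ?_⟩
  have hS0 : 0 < S := hR₀.trans_le hS
  have key := polyGauss_mul_pow_eq hR₀ hS hSR hroot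
  rw [hgS S hS hSR, hgS R₀ le_rfl hR₀R] at key
  have hrp : ∀ x : ℝ, 0 < x →
      (x ^ ((rootCount R Q : ℝ) / (p ^ N : ℕ))) ^ p ^ N = x ^ rootCount R Q := by
    intro x hx
    rw [← Real.rpow_natCast, ← Real.rpow_mul hx.le, div_mul_cancel₀ _ (by exact_mod_cast hpN),
      Real.rpow_natCast]
  have hMS := gauss_pos hf hS0
  refine (pow_left_inj₀ (by positivity) (by positivity) hpN).1 ?_
  rw [mul_pow, mul_pow, hrp _ hR₀, hrp _ hS0, key]

/-- The exponent from `exists_gauss_mul_rpow_eq` might vary with `R₀` and `R`. Comparing the radii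
`T` and `2 * T` identifies it as `f.kappa T`, which involves neither. -/
theorem gauss_mul_rpow_kappa_eq {R₀ T R : ℝ} (hR₀ : 0 < R₀) (hT : R₀ ≤ T) (hTR : 2 * T ≤ R)
    (h : ∀ z, f.eval z = 0 → ‖z‖ ≤ R → ‖z‖ ≤ R₀) {S : ℝ} (hS : R₀ ≤ S) (hSR : S ≤ R) :
    f.gauss S * T ^ f.kappa T = f.gauss T * S ^ f.kappa T := by
  have hT0 : 0 < T := hR₀.trans_le hT
  have hS0 : 0 < S := hR₀.trans_le hS
  obtain ⟨d, hd⟩ := exists_gauss_mul_rpow_eq hf hR₀ (by linarith) h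
  have h0 := gauss_pos hf hR₀
  have h1 := hd T hT (by linarith)
  have h2 := hd (2 * T) (by linarith) hTR
  have h3 := hd S hS hSR
  have hgT := gauss_pos hf hT0
  have hR₀d : 0 < R₀ ^ d := by positivity
  have hTd : 0 < T ^ d := by positivity
  have hk : f.kappa T = d := by
    rw [kappa]
    have : f.gauss (2 * T) / f.gauss T = 2 ^ d := by
      rw [div_eq_iff hgT.ne']
      apply mul_right_cancel₀ hR₀d.ne'
      rw [h2, Real.mul_rpow (by norm_num) hT0.le, mul_assoc, h1]
      ring
    rw [this, Real.logb_rpow (by norm_num) (by norm_num)]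
  rw [hk]
  apply mul_right_cancel₀ (mul_pos hR₀d h0).ne'
  linear_combination (T ^ d * f.gauss R₀) * h3 - S ^ d * f.gauss R₀ * h1

theorem exists_isGreatest_of_bounded {B : ℝ} (h : ∀ z, f.eval z = 0 → ‖z‖ ≤ B) :
    ∃ e, IsGreatest {e | f.coeff e ≠ 0} e := by
  set T := max B 1
  have hT : 0 < T := lt_max_of_lt_right one_pos
  have hgT := gauss_pos hf hT
  set d := f.kappa T
  have hTd : 0 < T ^ d := by positivity
  have key : ∀ S, T ≤ S → f.gauss S * T ^ d = f.gauss T * S ^ d := fun S hS =>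
    gauss_mul_rpow_kappa_eq hf hT le_rfl (le_max_right S (2 * T))
      (fun z hz _ => (h z hz).trans (le_max_left _ _)) hS (le_max_left _ _)
  -- A term of exponent greater than `d` would outgrow the Gauss norm.
  have hle : ∀ e, f.coeff e ≠ 0 → ((e : ℚ) : ℝ) ≤ d := by
    intro e he
    by_contra! hlt
    have ha : 0 < ‖f.coeff e‖ := norm_pos_iff.2 he
    have ht := tendsto_rpow_atTop (sub_pos.2 hlt)
    obtain ⟨S, hS, hST⟩ := ((ht.eventually_gt_atTop
      (f.gauss T / (‖f.coeff e‖ * T ^ d))).and (eventually_ge_atTop T)).exists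
    have hS0 : 0 < S := hT.trans_le hST
    have h1 := f.le_gauss hS0 e
    have h2 := key S hST
    rw [Real.rpow_sub hS0, div_lt_div_iff₀ (by positivity) (by positivity)] at hS
    nlinarith
  -- The term attaining the Gauss norm at `2 * T` is at most the Gauss norm at `T`, so it grows by
  -- at least `2 ^ d` and its exponent is at least `d`.
  obtain ⟨e, he⟩ := f.exists_eq_gauss (show 0 < 2 * T by positivity)
  have hpos := gauss_pos hf (show 0 < 2 * T by positivity)
  refine ⟨e, ?_, fun e' he' => ?_⟩
  · intro h0
    rw [he, h0, norm_zero, zero_mul] at hpos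
    exact hpos.false
  · have h1 := f.le_gauss hT e
    have h2 := key (2 * T) (by linarith)
    rw [he, Real.mul_rpow (by norm_num) hT.le, Real.mul_rpow (by norm_num) hT.le] at h2
    have h3 : (2 : ℝ) ^ d ≤ 2 ^ ((e : ℚ) : ℝ) := by
      have h4 : f.gauss T * T ^ d * 2 ^ d ≤ f.gauss T * T ^ d * 2 ^ ((e : ℚ) : ℝ) := by
        calc f.gauss T * T ^ d * 2 ^ d
            = (‖f.coeff e‖ * T ^ ((e : ℚ) : ℝ)) * (2 ^ ((e : ℚ) : ℝ) * T ^ d) := by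
              linear_combination -h2
          _ ≤ f.gauss T * (2 ^ ((e : ℚ) : ℝ) * T ^ d) := by gcongr
          _ = _ := by ring
      exact le_of_mul_le_mul_left h4 (by positivity)
    have h5 := (Real.rpow_le_rpow_left_iff (by norm_num)).1 h3
    have h6 := (hle e' he').trans h5
    exact Subtype.coe_le_coe.1 (by exact_mod_cast h6)

omit hf in
theorem eval_ne_zero_of_dominant {z : C} {e : Exponents p}
    (h0 : 0 < ‖f.coeff e‖ * ‖z‖ ^ ((e : ℚ) : ℝ))
    (h : ∀ e' ≠ e, ‖f.coeff e'‖ * ‖z‖ ^ ((e' : ℚ) : ℝ)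
      ≤ ‖f.coeff e‖ * ‖z‖ ^ ((e : ℚ) : ℝ) / 2) : f.eval z ≠ 0 := by
  classical
  intro hz
  have h1 : ‖f.eval z - f.coeff e * fracPow p z e‖ ≤ ‖f.coeff e‖ * ‖z‖ ^ ((e : ℚ) : ℝ) / 2 := by
    refine le_of_tendsto (((f.hasSum_eval z).sub_const (f.coeff e * fracPow p z e)).norm) ?_
    filter_upwards [eventually_ge_atTop {e}] with s hs
    have he : e ∈ s := hs (Finset.mem_singleton_self e)
    rw [← Finset.add_sum_erase s _ he, add_sub_cancel_left]
    refine IsUltrametricDist.norm_sum_le_of_forall_le_of_nonneg (by positivity) fun e' he' => ?_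
    rw [norm_mul, norm_fracPow]
    exact h e' (Finset.ne_of_mem_erase he')
  rw [hz, zero_sub, norm_neg, norm_mul, norm_fracPow] at h1
  linarith

omit hf in
-- Only finitely many coefficients exceed half the leading one, and their terms are eventually
-- dominated because their exponents are smaller. All other terms are dominated as soon as `‖z‖ ≥
-- 1`.
theorem exists_bound_of_isGreatest {e : Exponents p} (he : IsGreatest {e | f.coeff e ≠ 0} e) :
    ∃ B, ∀ z, f.eval z = 0 → ‖z‖ ≤ B := by
  have ha : 0 < ‖f.coeff e‖ := norm_pos_iff.2 he.1
  have hfin := f.finite_lt_norm_coeff_mul_rpow one_pos (half_pos ha)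
  have hev : ∀ᶠ S : ℝ in atTop,
      ∀ e' ∈ {e' | ‖f.coeff e‖ / 2 < ‖f.coeff e'‖ * 1 ^ ((e' : ℚ) : ℝ)}, e' ≠ e →
        ‖f.coeff e'‖ * S ^ ((e' : ℚ) : ℝ) ≤ ‖f.coeff e‖ * S ^ ((e : ℚ) : ℝ) / 2 := by
    rw [hfin.eventually_all]
    intro e' he'
    rcases eq_or_ne e' e with rfl | hne
    · simp
    have hlt : ((e' : ℚ) : ℝ) < ((e : ℚ) : ℝ) := by
      have h0 : f.coeff e' ≠ 0 := by
        intro h0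
        simp only [Set.mem_ofPred_eq, h0, norm_zero, zero_mul] at he'
        linarith
      have : e' < e := lt_of_le_of_ne (he.2 h0) hne
      exact_mod_cast this
    have ht := tendsto_rpow_atTop (sub_pos.2 hlt)
    filter_upwards [ht.eventually_ge_atTop (‖f.coeff e'‖ / (‖f.coeff e‖ / 2)),
      eventually_gt_atTop 0] with S hS hS0 _
    rw [Real.rpow_sub hS0, div_le_div_iff₀ (by positivity) (by positivity)] at hS
    linarith
  obtain ⟨B, hB⟩ := eventually_atTop.1 hev
  refine ⟨max B 1, fun z hz => ?_⟩
  by_contra! hlt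
  obtain ⟨hzB, hz1⟩ := max_lt_iff.1 hlt
  refine eval_ne_zero_of_dominant (f := f) (z := z) (e := e) (by positivity) (fun e' hne => ?_) hz
  by_cases hmem : e' ∈ {e' | ‖f.coeff e‖ / 2 < ‖f.coeff e'‖ * 1 ^ ((e' : ℚ) : ℝ)}
  · exact hB _ hzB.le e' hmem hne
  · simp only [Real.one_rpow, mul_one, Set.mem_ofPred_eq, not_lt] at hmem
    rcases eq_or_ne (f.coeff e') 0 with h0 | h0
    · rw [h0, norm_zero, zero_mul]
      positivity
    · have hle : ((e' : ℚ) : ℝ) ≤ ((e : ℚ) : ℝ) := by exact_mod_cast he.2 h0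
      calc ‖f.coeff e'‖ * ‖z‖ ^ ((e' : ℚ) : ℝ) ≤ ‖f.coeff e‖ / 2 * ‖z‖ ^ ((e : ℚ) : ℝ) := by
            gcongr
            exact hz1.le
        _ = _ := by ring

theorem isCompact_zeros_iff :
    IsCompact {z | f.eval z = 0} ↔ ∃ e, IsGreatest {e | f.coeff e ≠ 0} e := by
  constructor
  · intro h
    obtain ⟨B, hB⟩ := h.isBounded.exists_norm_le
    exact exists_isGreatest_of_bounded hf hB
  · rintro ⟨e, he⟩
    obtain ⟨B, hB⟩ := exists_bound_of_isGreatest he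
    convert isCompact_zeros_inter_ball hf (R := max B 1) (lt_max_of_lt_right one_pos) using 1
    ext z
    simp only [Set.mem_ofPred_eq]
    exact ⟨fun h => ⟨h, (hB z h).trans (le_max_left _ _)⟩, fun h => h.1⟩

/-- In a Hausdorff space one compact neighbourhood of each point is enough. -/
theorem locallyCompactSpace_zeros : LocallyCompactSpace {z | f.eval z = 0} := by
  have hW : WeaklyLocallyCompactSpace {z | f.eval z = 0} := by
    refine ⟨fun x => ?_⟩
    have hR : 0 < ‖(x : C)‖ + 1 := by positivity
    refine ⟨Subtype.val ⁻¹' {z | f.eval z = 0 ∧ ‖z‖ ≤ ‖(x : C)‖ + 1}, ?_, ?_⟩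
    · rw [Subtype.isCompact_iff, Subtype.image_preimage_coe]
      convert isCompact_zeros_inter_ball hf hR using 1
      ext z
      simp
    · have : {y : {z | f.eval z = 0} | ‖(y : C)‖ < ‖(x : C)‖ + 1} ∈ 𝓝 x :=
        (isOpen_lt (by fun_prop) continuous_const).mem_nhds (by simp)
      filter_upwards [this] with y hy
      exact ⟨y.2, le_of_lt hy⟩
  infer_instance

end FracPowerSeries

end Series

end FracSeries

namespace FracSeries

/-! ### Subtraction of constants, and zeros near the origin -/

section Series

variable {C : Type*} [NormedField C] [IsAlgClosed C] {p : ℕ} [Fact p.Prime] [CharP C p]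

theorem tendsto_rpow_nhdsGT_zero {x : ℝ} (hx : 0 < x) :
    Tendsto (fun S : ℝ => S ^ x) (𝓝[>] 0) (𝓝 0) := by
  have := (Real.continuousAt_rpow_const 0 x (Or.inr hx.le)).tendsto
  rw [Real.zero_rpow hx.ne'] at this
  exact this.mono_left nhdsWithin_le_nhds

namespace FracPowerSeries

variable (f : FracPowerSeries C p)

open Classical in
/-- The series `f - c`. -/
noncomputable def subConst (c : C) : FracPowerSeries C p where
  coeff e := f.coeff e - if (e : ℚ) = 0 then c else 0
  converges z r hr := by
    refine ((f.converges z r hr).union (Set.finite_singleton ⟨0, 0, 0, by simp⟩)).subset ?_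
    intro e he
    by_cases h0 : (e : ℚ) = 0
    · exact Or.inr (Subtype.ext h0)
    · left
      simpa [h0] using he

theorem fracPow_zero {e : Exponents p} (he : (e : ℚ) = 0) (z : C) : fracPow p z e = 1 := by
  rw [fracPow_eq p z e 0 0 (by simp [he])]
  simp

theorem eval_subConst [IsUltrametricDist C] [CompleteSpace C] (c z : C) :
    (f.subConst c).eval z = f.eval z - c := by
  classical
  set e₀ : Exponents p := ⟨0, 0, 0, by simp⟩
  refine ((f.subConst c).hasSum_eval z).unique ?_
  have hfun : (fun e => (f.subConst c).coeff e * fracPow p z e)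
      = fun e => f.coeff e * fracPow p z e - if e = e₀ then c else 0 := by
    funext e
    by_cases h0 : (e : ℚ) = 0
    · have he : e = e₀ := Subtype.ext h0
      simp [subConst, fracPow_zero h0, h0, if_pos he]
    · have he : e ≠ e₀ := fun h => h0 (congrArg Subtype.val h)
      simp [subConst, h0, he]
  rw [hfun]
  exact (f.hasSum_eval z).sub (hasSum_ite_eq e₀ c)

/-- A nonzero exponent occurs in both series, so a largest exponent is positive and the constant
term is irrelevant. -/
theorem isGreatest_subConst_iff (hf : ¬ f.IsConstant) (c : C) (e : Exponents p) :
    IsGreatest {e | (f.subConst c).coeff e ≠ 0} e ↔ IsGreatest {e | f.coeff e ≠ 0} e := by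
  classical
  simp only [IsConstant, not_forall] at hf
  obtain ⟨e₁, h₁, h₁'⟩ := hf
  have key : ∀ a b : Exponents p → C, (∀ e : Exponents p, (e : ℚ) ≠ 0 → a e = b e) → a e₁ ≠ 0 → b e₁ ≠ 0 →
      IsGreatest {e | a e ≠ 0} e → IsGreatest {e | b e ≠ 0} e := by
    intro a b hab ha hb h
    have hpos : ∀ e : Exponents p, (0 : ℚ) ≤ e := fun e => by
      have := exponents_nonneg e
      exact_mod_cast this
    have h1 : (0 : ℚ) < e₁ := lt_of_le_of_ne (hpos e₁) (Ne.symm h₁)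
    have h2 : (e₁ : ℚ) ≤ e := h.2 ha
    refine ⟨?_, fun e' he' => ?_⟩
    · rw [Set.mem_ofPred_eq, ← hab e (h1.trans_le h2).ne']
      exact h.1
    · by_cases h0 : (e' : ℚ) = 0
      · rw [← Subtype.coe_le_coe, h0]
        exact hpos e
      · refine h.2 ?_
        rw [Set.mem_ofPred_eq, hab e' h0]
        exact he'
  have heq : ∀ e : Exponents p, (e : ℚ) ≠ 0 → (f.subConst c).coeff e = f.coeff e := by
    intro e he
    simp [subConst, he]
  have h3 : (f.subConst c).coeff e₁ ≠ 0 := by rwa [heq e₁ h₁]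
  exact ⟨key _ _ heq h3 h₁', key _ _ (fun e he => (heq e he).symm) h₁' h3⟩

theorem subConst_coeff_ne_zero (hf : ¬ f.IsConstant) (c : C) : (f.subConst c).coeff ≠ 0 := by
  simp only [IsConstant, not_forall] at hf
  obtain ⟨e, he, he'⟩ := hf
  refine Function.ne_iff.2 ⟨e, ?_⟩
  simpa [subConst, he] using he'

theorem fiber_eq [IsUltrametricDist C] [CompleteSpace C] (c : C) :
    {z | f.eval z = c} = {z | (f.subConst c).eval z = 0} := by
  ext z
  rw [Set.mem_ofPred_eq, Set.mem_ofPred_eq, eval_subConst, sub_eq_zero]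

variable {f}

theorem exists_gauss_lt (hpos : ∀ e, f.coeff e ≠ 0 → (0 : ℚ) < e) {η R : ℝ} (hη : 0 < η)
    (hR : 0 < R) : ∃ δ, 0 < δ ∧ δ ≤ R ∧ f.gauss δ < η := by
  have hfin := f.finite_lt_norm_coeff_mul_rpow one_pos (half_pos hη)
  have hev : ∀ᶠ S : ℝ in 𝓝[>] 0,
      ∀ e ∈ {e | η / 2 < ‖f.coeff e‖ * 1 ^ ((e : ℚ) : ℝ)},
        ‖f.coeff e‖ * S ^ ((e : ℚ) : ℝ) < η := by
    rw [hfin.eventually_all]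
    intro e he
    have h0 : f.coeff e ≠ 0 := by
      intro h0
      simp only [Set.mem_ofPred_eq, h0, norm_zero, zero_mul] at he
      linarith
    have ht := (tendsto_rpow_nhdsGT_zero (x := ((e : ℚ) : ℝ))
      (by exact_mod_cast hpos e h0)).const_mul ‖f.coeff e‖
    rw [mul_zero] at ht
    exact ht.eventually_lt_const hη
  obtain ⟨δ, ⟨h1, h2⟩, h3⟩ :=
    ((hev.and (Ioc_mem_nhdsGT hR)).and (Ioc_mem_nhdsGT one_pos)).exists
  refine ⟨δ, h2.1, h2.2, ?_⟩
  obtain ⟨e, he⟩ := f.exists_eq_gauss h2.1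
  rw [he]
  by_cases hmem : e ∈ {e | η / 2 < ‖f.coeff e‖ * 1 ^ ((e : ℚ) : ℝ)}
  · exact h1 e hmem
  · simp only [Real.one_rpow, mul_one, Set.mem_ofPred_eq, not_lt] at hmem
    have := Real.rpow_le_one h2.1.le h3.2 (exponents_nonneg e)
    have h0 : 0 ≤ δ ^ ((e : ℚ) : ℝ) := Real.rpow_nonneg h2.1.le _
    calc ‖f.coeff e‖ * δ ^ ((e : ℚ) : ℝ) ≤ η / 2 * 1 := by gcongr
      _ < η := by linarith

variable [IsUltrametricDist C] [CompleteSpace C]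

/-- The counterpart of `exists_bound_of_isGreatest` as the radius tends to `0`: the term of least
exponent dominates. -/
theorem exists_ne_zero_of_isLeast {e : Exponents p} (he : IsLeast {e | f.coeff e ≠ 0} e) :
    ∃ δ, 0 < δ ∧ ∀ z, f.eval z = 0 → ‖z‖ ≤ δ → z = 0 := by
  have ha : 0 < ‖f.coeff e‖ := norm_pos_iff.2 he.1
  have hfin := f.finite_lt_norm_coeff_mul_rpow one_pos (half_pos ha)
  have hev : ∀ᶠ S : ℝ in 𝓝[>] 0,
      ∀ e' ∈ {e' | ‖f.coeff e‖ / 2 < ‖f.coeff e'‖ * 1 ^ ((e' : ℚ) : ℝ)}, e' ≠ e →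
        ‖f.coeff e'‖ * S ^ ((e' : ℚ) : ℝ) ≤ ‖f.coeff e‖ * S ^ ((e : ℚ) : ℝ) / 2 := by
    rw [hfin.eventually_all]
    intro e' he'
    rcases eq_or_ne e' e with rfl | hne
    · simp
    have h0 : f.coeff e' ≠ 0 := by
      intro h0
      simp only [Set.mem_ofPred_eq, h0, norm_zero, zero_mul] at he'
      linarith
    have hlt : ((e : ℚ) : ℝ) < ((e' : ℚ) : ℝ) := by
      have : e < e' := lt_of_le_of_ne (he.2 h0) hne.symm
      exact_mod_cast this
    have ha' : 0 < ‖f.coeff e'‖ := norm_pos_iff.2 h0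
    have ht := tendsto_rpow_nhdsGT_zero (sub_pos.2 hlt)
    filter_upwards [ht.eventually_lt_const (show 0 < ‖f.coeff e‖ / 2 / ‖f.coeff e'‖ by positivity),
      self_mem_nhdsWithin] with S hS hS0 _
    have hS0 : 0 < S := hS0
    rw [Real.rpow_sub hS0, div_lt_div_iff₀ (by positivity) (by positivity)] at hS
    linarith
  obtain ⟨δ, hδ, h⟩ := (mem_nhdsGT_iff_exists_Ioc_subset.1 hev)
  refine ⟨min δ 1, lt_min hδ one_pos, fun z hz hzδ => ?_⟩
  by_contra hz0
  have hz0 : 0 < ‖z‖ := norm_pos_iff.2 hz0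
  refine eval_ne_zero_of_dominant (f := f) (z := z) (e := e) (by positivity) (fun e' hne => ?_) hz
  by_cases hmem : e' ∈ {e' | ‖f.coeff e‖ / 2 < ‖f.coeff e'‖ * 1 ^ ((e' : ℚ) : ℝ)}
  · exact h ⟨hz0, hzδ.trans (min_le_left _ _)⟩ e' hmem hne
  · simp only [Real.one_rpow, mul_one, Set.mem_ofPred_eq, not_lt] at hmem
    rcases eq_or_ne (f.coeff e') 0 with h0 | h0
    · rw [h0, norm_zero, zero_mul]
      positivity
    · have hle : ((e : ℚ) : ℝ) ≤ ((e' : ℚ) : ℝ) := by exact_mod_cast he.2 h0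
      have := Real.rpow_le_rpow_of_exponent_ge hz0 (hzδ.trans (min_le_right _ _)) hle
      calc ‖f.coeff e'‖ * ‖z‖ ^ ((e' : ℚ) : ℝ) ≤ ‖f.coeff e‖ / 2 * ‖z‖ ^ ((e : ℚ) : ℝ) := by gcongr
        _ = _ := by ring

theorem exists_isLeast_of_zeros (hf : f.coeff ≠ 0) {δ : ℝ} (hδ : 0 < δ)
    (h : ∀ z, f.eval z = 0 → ‖z‖ ≤ δ → z = 0) : ∃ e, IsLeast {e | f.coeff e ≠ 0} e := by
  set T := δ / 2 with hT'
  have hT : 0 < T := half_pos hδ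
  have hgT := gauss_pos hf hT
  set d := f.kappa T
  have hTd : 0 < T ^ d := by positivity
  -- The inner radius `min S T` may shrink with `S`, since the exponent `f.kappa T` does not depend
  -- on it.
  have key : ∀ S, 0 < S → S ≤ δ → f.gauss S * T ^ d = f.gauss T * S ^ d := fun S hS hSδ =>
    gauss_mul_rpow_kappa_eq hf (lt_min hS hT) (min_le_right S T) (show 2 * T ≤ δ by linarith)
      (fun z hz hzδ => by
        rw [h z hz hzδ, norm_zero]
        exact (lt_min hS hT).le) (min_le_left _ _) hSδ
  have hle : ∀ e, f.coeff e ≠ 0 → d ≤ ((e : ℚ) : ℝ) := by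
    intro e he
    by_contra! hlt
    have ha : 0 < ‖f.coeff e‖ := norm_pos_iff.2 he
    have ht := tendsto_rpow_nhdsGT_zero (sub_pos.2 hlt)
    obtain ⟨S, hS, hST⟩ := ((ht.eventually_lt_const (show 0 < ‖f.coeff e‖ * T ^ d / f.gauss T by
      positivity)).and (Ioc_mem_nhdsGT hδ)).exists
    have hS0 : 0 < S := hST.1
    have h1 := f.le_gauss hS0 e
    have h2 := key S hST.1 hST.2
    rw [Real.rpow_sub hS0, div_lt_div_iff₀ (by positivity) (by positivity)] at hS
    nlinarith
  -- The term attaining the Gauss norm at `T` grows by at most `2 ^ d` up to `2 * T`, so its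
  -- exponent is at most `d`.
  obtain ⟨e, he⟩ := f.exists_eq_gauss hT
  refine ⟨e, ?_, fun e' he' => ?_⟩
  · intro h0
    rw [he, h0, norm_zero, zero_mul] at hgT
    exact hgT.false
  · have h1 := f.le_gauss (show 0 < 2 * T by positivity) e
    have h2 := key (2 * T) (by positivity) (by linarith)
    rw [Real.mul_rpow (by norm_num) hT.le] at h1 h2
    have h3 : (2 : ℝ) ^ ((e : ℚ) : ℝ) ≤ 2 ^ d := by
      have h4 : f.gauss T * T ^ d * 2 ^ ((e : ℚ) : ℝ) ≤ f.gauss T * T ^ d * 2 ^ d := by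
        calc f.gauss T * T ^ d * 2 ^ ((e : ℚ) : ℝ)
            = ‖f.coeff e‖ * (2 ^ ((e : ℚ) : ℝ) * T ^ ((e : ℚ) : ℝ)) * T ^ d := by
              rw [he]; ring
          _ ≤ f.gauss (2 * T) * T ^ d := by gcongr
          _ = _ := by linear_combination h2
      exact le_of_mul_le_mul_left h4 (by positivity)
    have h5 := (Real.rpow_le_rpow_left_iff (by norm_num)).1 h3
    have h6 := h5.trans (hle e' he')
    exact Subtype.coe_le_coe.1 (by exact_mod_cast h6)

end FracPowerSeries

end Series

end FracSeries

namespace FracSeries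

/-! ### Linear series and their kernels -/

section Linear

variable {C : Type*} [NormedField C] [IsAlgClosed C] {p : ℕ} [Fact p.Prime] [CharP C p]
variable {k : ℕ} {F : Type*} [Field F] [Algebra F C]

theorem fracPow_qExponent (z : C) (n : ℤ) :
    fracPow p z (qExponent p k n) = ((frobeniusEquiv C p : RingAut C) ^ ((k : ℤ) * n)) z := by
  rw [fracPow_eq p z (qExponent p k n) 1 (k * n) (by
    rw [qExponent, zpow_mul]; simp), pow_one]

theorem fracPow_qExponent_add (x y : C) (n : ℤ) : fracPow p (x + y) (qExponent p k n)
    = fracPow p x (qExponent p k n) + fracPow p y (qExponent p k n) := by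
  simp only [fracPow_qExponent, map_add]

theorem fracPow_qExponent_smul (hF : Nat.card F = p ^ k) (c : F) (x : C) (n : ℤ) :
    fracPow p (c • x) (qExponent p k n) = c • fracPow p x (qExponent p k n) := by
  simp only [fracPow_qExponent, Algebra.smul_def, map_mul]
  congr 1
  have hfin : Finite F := Nat.finite_of_card_ne_zero
    (hF ▸ pow_ne_zero _ (Fact.out : p.Prime).ne_zero)
  -- Elements of `F` are fixed by the `p ^ k`-power map. As stabilizers are subgroups, its negative
  -- powers fix them too.
  have hmem : (frobeniusEquiv C p : RingAut C) ^ (k : ℤ)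
      ∈ MulAction.stabilizer (RingAut C) (algebraMap F C c) := by
    rw [MulAction.mem_stabilizer_iff, RingAut.smul_def, frobenius_zpow_natCast, ← map_pow, ← hF]
    have := Fintype.ofFinite F
    rw [Nat.card_eq_fintype_card, FiniteField.pow_card]
  rw [zpow_mul]
  exact (zpow_mem hmem n : _)

/-- This replaces the assumption `k ≥ 1`: a field has at least two elements. -/
theorem one_lt_of_card (hF : Nat.card F = p ^ k) : 1 < p ^ k := by
  have hfin : Finite F := Nat.finite_of_card_ne_zero
    (hF ▸ pow_ne_zero _ (Fact.out : p.Prime).ne_zero)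
  rw [← hF]
  exact Finite.one_lt_card

omit [Fact p.Prime] in
theorem qExponent_le_iff (hq : 1 < p ^ k) {m n : ℤ} :
    qExponent p k m ≤ qExponent p k n ↔ m ≤ n := by
  rw [← Subtype.coe_le_coe]
  exact zpow_le_zpow_iff_right₀ (by exact_mod_cast hq)

namespace FracPowerSeries

variable {f : FracPowerSeries C p} (hf : f ∈ LinearSeries C p k)
include hf

theorem coeff_mul_fracPow_add (x y : C) (e : Exponents p) :
    f.coeff e * fracPow p (x + y) e = f.coeff e * fracPow p x e + f.coeff e * fracPow p y e := by
  by_cases h0 : f.coeff e = 0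
  · simp [h0]
  · obtain ⟨n, rfl⟩ := hf e h0
    rw [fracPow_qExponent_add, mul_add]

theorem trunc_add {R ε : ℝ} (hR : 0 < R) (hε : 0 < ε) (x y : C) :
    f.trunc hR hε (x + y) = f.trunc hR hε x + f.trunc hR hε y := by
  simp only [trunc, coeff_mul_fracPow_add hf, Finset.sum_add_distrib]

theorem exists_isGreatest_iff (hq : 1 < p ^ k) (hf0 : f.coeff ≠ 0) :
    (∃ e, IsGreatest {e | f.coeff e ≠ 0} e) ↔
      ∃ N : ℤ, ∀ n > N, f.coeff (qExponent p k n) = 0 := by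
  constructor
  · rintro ⟨e, he, hmax⟩
    obtain ⟨N, rfl⟩ := hf e he
    refine ⟨N, fun n hn => ?_⟩
    by_contra h
    exact absurd ((qExponent_le_iff hq).1 (hmax h)) (not_le.2 hn)
  · rintro ⟨N, hN⟩
    obtain ⟨e, he⟩ := Function.ne_iff.1 hf0
    obtain ⟨n, rfl⟩ := hf e he
    obtain ⟨M, hM, hmax⟩ := Int.exists_greatest_of_bdd
      (P := fun n => f.coeff (qExponent p k n) ≠ 0)
      ⟨N, fun m hm => not_lt.1 fun h => hm (hN m h)⟩ ⟨n, he⟩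
    refine ⟨_, hM, fun e' he' => ?_⟩
    obtain ⟨n', rfl⟩ := hf e' he'
    exact (qExponent_le_iff hq).2 (hmax n' he')

theorem exists_isLeast_iff (hq : 1 < p ^ k) (hf0 : f.coeff ≠ 0) :
    (∃ e, IsLeast {e | f.coeff e ≠ 0} e) ↔
      ∃ N : ℤ, ∀ n < N, f.coeff (qExponent p k n) = 0 := by
  constructor
  · rintro ⟨e, he, hmin⟩
    obtain ⟨N, rfl⟩ := hf e he
    refine ⟨N, fun n hn => ?_⟩
    by_contra h
    exact absurd ((qExponent_le_iff hq).1 (hmin h)) (not_le.2 hn)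
  · rintro ⟨N, hN⟩
    obtain ⟨e, he⟩ := Function.ne_iff.1 hf0
    obtain ⟨n, rfl⟩ := hf e he
    obtain ⟨M, hM, hmin⟩ := Int.exists_least_of_bdd
      (P := fun n => f.coeff (qExponent p k n) ≠ 0)
      ⟨N, fun m hm => not_lt.1 fun h => hm (hN m h)⟩ ⟨n, he⟩
    refine ⟨_, hM, fun e' he' => ?_⟩
    obtain ⟨n', rfl⟩ := hf e' he'
    exact (qExponent_le_iff hq).2 (hmin n' he')

theorem exponent_pos (e : Exponents p) (he : f.coeff e ≠ 0) : (0 : ℚ) < e := by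
  obtain ⟨n, rfl⟩ := hf e he
  have : 0 < p := (Fact.out : p.Prime).pos
  simp only [qExponent]
  positivity

variable [IsUltrametricDist C] [CompleteSpace C]

theorem eval_add (x y : C) : f.eval (x + y) = f.eval x + f.eval y := by
  refine (f.hasSum_eval (x + y)).unique ?_
  simp only [coeff_mul_fracPow_add hf]
  exact (f.hasSum_eval x).add (f.hasSum_eval y)

theorem eval_smul (hF : Nat.card F = p ^ k) (c : F) (x : C) : f.eval (c • x) = c • f.eval x := by
  refine (f.hasSum_eval (c • x)).unique ?_
  have : ∀ e, f.coeff e * fracPow p (c • x) e = algebraMap F C c * (f.coeff e * fracPow p x e) := by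
    intro e
    by_cases h0 : f.coeff e = 0
    · simp [h0]
    · obtain ⟨n, rfl⟩ := hf e h0
      rw [fracPow_qExponent_smul hF, Algebra.smul_def]
      ring
  simp only [this]
  rw [Algebra.smul_def c (f.eval x)]
  exact (f.hasSum_eval x).mul_left _

/-- The kernel of a linear series. -/
noncomputable def ker (hF : Nat.card F = p ^ k) : Submodule F C where
  carrier := {z | f.eval z = 0}
  add_mem' {x y} hx hy := by
    rw [Set.mem_ofPred_eq] at *
    rw [eval_add hf, hx, hy, add_zero]
  zero_mem' := by
    have := eval_smul hf hF (0 : F) (0 : C)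
    simpa using this
  smul_mem' c x hx := by
    rw [Set.mem_ofPred_eq] at *
    rw [eval_smul hf hF, hx, smul_zero]

end FracPowerSeries

end Linear

/-! ### Cosets of `G ∩ Δ_r` and discreteness -/

section ClassG

variable {C : Type*} [NormedField C] [IsUltrametricDist C] {F : Type*} [Field F] [Algebra F C]
  {G : Submodule F C}

theorem mem_interBall {r : ℝ} {hr : 0 < r} {x : C} : x ∈ interBall G r hr ↔ x ∈ G ∧ ‖x‖ ≤ r :=
  Iff.rfl

/-- The elements of `G` of norm at most `R` lie in a compact set, covered by finitely many `r`-balls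
centred in `G`; the points of `G` in one such ball lie in a single coset. Both parts of condition
(3) rest on this. -/
theorem finite_classes (hG : ∀ R : ℝ, 0 < R → IsCompact {x | x ∈ G ∧ ‖x‖ ≤ R}) {r : ℝ}
    (hr : 0 < r) (R : ℝ) :
    ((fun g : G.toAddSubgroup => (QuotientAddGroup.mk g :
      G.toAddSubgroup ⧸ (interBall G r hr).addSubgroupOf G.toAddSubgroup)) ''
        {g | ‖(g : C)‖ ≤ R}).Finite := by
  obtain ⟨t, htG, htfin, ht⟩ := (hG (max R 1) (lt_max_of_lt_right one_pos)).finite_cover_balls hr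
  have hfin : ((Subtype.val : G.toAddSubgroup → C) ⁻¹' t).Finite :=
    htfin.preimage Subtype.val_injective.injOn
  refine (hfin.image (fun g : G.toAddSubgroup => (QuotientAddGroup.mk g :
      G.toAddSubgroup ⧸ (interBall G r hr).addSubgroupOf G.toAddSubgroup))).subset ?_
  rintro _ ⟨g, hg, rfl⟩
  obtain ⟨x, hx, hgx⟩ := Set.mem_iUnion₂.1 (ht ⟨g.2, le_max_of_le_left hg⟩)
  refine ⟨⟨x, (htG hx).1⟩, hx, ?_⟩
  rw [QuotientAddGroup.eq, AddSubgroup.mem_addSubgroupOf, mem_interBall]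
  refine ⟨SetLike.coe_mem (-(⟨x, (htG hx).1⟩ : G.toAddSubgroup) + g), ?_⟩
  rw [Metric.mem_ball, dist_eq_norm] at hgx
  rw [AddSubgroup.coe_add, AddSubgroup.coe_neg, neg_add_eq_sub]
  exact hgx.le

theorem countable_quotient (hG : ∀ R : ℝ, 0 < R → IsCompact {x | x ∈ G ∧ ‖x‖ ≤ R}) {r : ℝ}
    (hr : 0 < r) :
    Countable (G.toAddSubgroup ⧸ (interBall G r hr).addSubgroupOf G.toAddSubgroup) := by
  rw [← Set.countable_univ_iff]
  refine (Set.countable_iUnion fun n : ℕ => (finite_classes hG hr n).countable).mono ?_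
  intro a _
  obtain ⟨g, rfl⟩ := QuotientAddGroup.mk_surjective a
  obtain ⟨n, hn⟩ := exists_nat_ge ‖(g : C)‖
  exact Set.mem_iUnion.2 ⟨n, g, hn, rfl⟩

theorem tendsto_norm_atTop (hG : ∀ R : ℝ, 0 < R → IsCompact {x | x ∈ G ∧ ‖x‖ ≤ R}) {r : ℝ}
    (hr : 0 < r) {g : ℕ → G.toAddSubgroup}
    (hg : Function.Injective (fun n => (QuotientAddGroup.mk (g n) :
      G.toAddSubgroup ⧸ (interBall G r hr).addSubgroupOf G.toAddSubgroup))) :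
    Tendsto (fun n => ‖(g n : C)‖) atTop atTop := by
  refine tendsto_atTop.2 fun R => ?_
  rw [← Nat.cofinite_eq_atTop, eventually_cofinite]
  refine ((finite_classes hG hr R).preimage hg.injOn).subset fun n hn => ?_
  exact ⟨g n, (not_le.1 hn).le, rfl⟩

theorem discreteTopology_iff : DiscreteTopology G ↔ ∃ δ, 0 < δ ∧ ∀ z ∈ G, ‖z‖ ≤ δ → z = 0 := by
  rw [discreteTopology_iff_isOpen_singleton_zero, Metric.isOpen_singleton_iff]
  constructor
  · rintro ⟨ε, hε, h⟩
    refine ⟨ε / 2, half_pos hε, fun z hz hzε => ?_⟩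
    have := h ⟨z, hz⟩ (by
      rw [dist_zero_right]
      exact lt_of_le_of_lt hzε (half_lt_self hε))
    exact congrArg Subtype.val this
  · rintro ⟨δ, hδ, h⟩
    refine ⟨δ, hδ, fun y hy => Subtype.ext (h y y.2 ?_)⟩
    rw [dist_zero_right] at hy
    exact le_of_lt hy

end ClassG

end FracSeries

/-! ### Jensen's formula for linear series -/

namespace FracSeries

theorem sum_map_eq_sum_countP {α ι : Type*} [Fintype ι] (P : ι → α → Prop)
    [∀ i, DecidablePred (P i)] (F : α → ℝ) (c : ι → ℝ) (s : Multiset α)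
    (h : ∀ a ∈ s, ∃ i, P i a ∧ F a = c i ∧ ∀ j, P j a → j = i) :
    (s.map F).sum = ∑ i, (s.countP (P i) : ℝ) * c i := by
  classical
  induction s using Multiset.induction_on with
  | empty => simp
  | cons a s ih =>
    have ih := ih fun b hb => h b (Multiset.mem_cons_of_mem hb)
    obtain ⟨i, hi, hF, huniq⟩ := h a (Multiset.mem_cons_self a s)
    have : ∀ j, P j a ↔ j = i := fun j => ⟨huniq j, fun h => h ▸ hi⟩
    simp only [Multiset.map_cons, Multiset.sum_cons, ih, hF, Multiset.countP_cons, this,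
      Nat.cast_add, add_mul, Finset.sum_add_distrib, Nat.cast_ite, Nat.cast_one, Nat.cast_zero,
      ite_mul, one_mul, zero_mul, Finset.sum_ite_eq', Finset.mem_univ, if_true]
    ring

theorem sum_map_log {α : Type*} (F : α → ℝ) (s : Multiset α) (h : ∀ a ∈ s, 0 < F a) :
    (s.map fun a => Real.log (F a)).sum = Real.log (s.map F).prod := by
  induction s using Multiset.induction_on with
  | empty => simp
  | cons a s ih =>
    have hs := fun b hb => h b (Multiset.mem_cons_of_mem hb)
    have hpos : 0 < (s.map F).prod := Multiset.prod_pos fun x hx => by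
      obtain ⟨b, hb, rfl⟩ := Multiset.mem_map.1 hx
      exact hs b hb
    rw [Multiset.map_cons, Multiset.sum_cons, ih hs, Multiset.map_cons, Multiset.prod_cons,
      Real.log_mul (h a (Multiset.mem_cons_self a s)).ne' hpos.ne']

theorem max_norm_eq_of_norm_sub_le {C : Type*} [NormedField C] [IsUltrametricDist C] {δ : ℝ}
    {x y : C} (h : ‖x - y‖ ≤ δ) : max δ ‖x‖ = max δ ‖y‖ := by
  apply le_antisymm
  · refine max_le (le_max_left _ _) ?_
    rw [← sub_add_cancel x y]
    exact (IsUltrametricDist.norm_add_le_max _ _).trans (max_le_max_right _ h)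
  · refine max_le (le_max_left _ _) ?_
    rw [norm_sub_rev] at h
    rw [← sub_add_cancel y x]
    exact (IsUltrametricDist.norm_add_le_max _ _).trans (max_le_max_right _ h)

theorem norm_sub_le_of_le_of_le {C : Type*} [NormedField C] [IsUltrametricDist C] {δ : ℝ}
    {x y z : C} (h : ‖x - y‖ ≤ δ) (h' : ‖y - z‖ ≤ δ) : ‖x - z‖ ≤ δ := by
  rw [← sub_add_sub_cancel x y z]
  exact (IsUltrametricDist.norm_add_le_max _ _).trans (max_le h h')

namespace FracPowerSeries

variable {C : Type*} [NormedField C] [IsAlgClosed C] {p : ℕ} [Fact p.Prime] [CharP C p]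
variable [IsUltrametricDist C] [CompleteSpace C] {k : ℕ} {f : FracPowerSeries C p}

/-- Jensen's formula for linear series, for the mean value of `log (r / max δ |x|)` over the zeros
`x` in the disk of radius `r`. -/
theorem log_gauss_mul_card_le (hf : f ∈ LinearSeries C p k) (hf0 : f.coeff ≠ 0) {r δ : ℝ}
    (hδ : 0 < δ) (hδr : δ ≤ r) {A : Type*} [Fintype A] (t : A → C) (ht0 : ∀ a, f.eval (t a) = 0)
    (htr : ∀ a, ‖t a‖ ≤ r) (hcov : ∀ z, f.eval z = 0 → ‖z‖ ≤ r → ∃ a, ‖z - t a‖ ≤ δ)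
    (hsep : ∀ a b, ‖t a - t b‖ ≤ δ → a = b) :
    (Real.log (f.gauss r) - Real.log (f.gauss δ)) * Fintype.card A
      ≤ f.kappa r * ∑ a, (Real.log r - Real.log (max δ ‖t a‖)) := by
  have hr : 0 < r := hδ.trans_le hδr
  have hr2 : 0 < 2 * r := by positivity
  have hMδ := gauss_pos hf0 hδ
  have hM := gauss_pos hf0 hr
  have hs0 : 0 < δ / r := by positivity
  have hs1 : δ / r ≤ 1 := (div_le_one hr).2 hδr
  have hMs : 0 < f.gauss r * (δ / r) ^ f.kappa r := by positivity
  obtain ⟨ε, hε, hεlt⟩ := exists_between (lt_min hMδ hMs)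
  obtain ⟨h1, h2⟩ := lt_min_iff.1 hεlt
  have h1r : ε < f.gauss r := h1.trans_le (f.gauss_mono hδ hδr)
  obtain ⟨N, Q, hQ, hg⟩ := f.exists_polynomial hr2 hε
  have hpN : p ^ N ≠ 0 := pow_ne_zero _ (Fact.out : p.Prime).ne_zero
  have hgδ := hg δ hδ (by linarith) h1
  have hgr := hg r hr (by linarith) h1r
  have hg2 := hg (2 * r) hr2 le_rfl (h1r.trans_le (f.gauss_mono hr (by linarith)))
  have hQadd : ∀ x y, Q.eval (x + y) = Q.eval x + Q.eval y := by
    intro x y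
    rw [hQ, hQ, hQ, trunc_add hf, add_pow_char_pow]
  have hzero : ∀ a, Q.eval a = 0 ↔ f.trunc hr2 hε a = 0 := fun a => by
    rw [hQ, pow_eq_zero_iff hpN]
  have hrt : δ / r * r = δ := div_mul_cancel₀ _ hr.ne'
  set s := Q.roots.filter fun x => ‖x‖ ≤ r with hs
  have hcount : ∀ a, s.countP (fun x => ‖x - t a‖ ≤ δ) = rootCount δ Q := by
    -- Near the zero `t a` of `f` there is a root of `Q`, so additivity gives this disk as many
    -- roots as the `δ`-disk around `0`.
    intro a
    have h3 := f.norm_eval_sub_trunc_le hr2 hε (z := t a) (by linarith [htr a])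
    rw [ht0, zero_sub, norm_neg] at h3
    obtain ⟨b, hb, hab⟩ := exists_trunc_eq_zero hf0 hr hε h1r hs0 hs1 (htr a) (h3.trans_lt h2)
    rw [hrt, norm_sub_rev] at hab
    rw [← countP_roots_disk_eq hQadd ((hzero b).2 hb) hab.le, hs, Multiset.countP_filter]
    refine Multiset.countP_congr rfl fun x _ => ?_
    refine propext ⟨fun h => h.1, fun h => ⟨h, ?_⟩⟩
    rw [← sub_add_cancel x (t a)]
    exact (IsUltrametricDist.norm_add_le_max _ _).trans (max_le (h.trans hδr) (htr a))
  -- Conversely, a root of `Q` in the disk of radius `r` is within `δ` of a zero of `f`, so it lies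
  -- in exactly one of these disks.
  have hpart : ∀ x ∈ s, ∃ a, ‖x - t a‖ ≤ δ ∧ ∀ b, ‖x - t b‖ ≤ δ → b = a := by
    intro x hx
    obtain ⟨hxr, hxn⟩ := Multiset.mem_filter.1 hx
    obtain ⟨y, hy, hxy⟩ := exists_norm_sub_le_of_trunc_eq_zero hf0 hr hs0 hs1 hε h2 hxn
      ((hzero x).1 (Polynomial.mem_roots'.1 hxr).2)
    rw [hrt] at hxy
    have hyr : ‖y‖ ≤ r := by
      rw [norm_sub_rev] at hxy
      rw [← sub_add_cancel y x]
      exact (IsUltrametricDist.norm_add_le_max _ _).trans (max_le (hxy.trans hδr) hxn)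
    obtain ⟨a, ha⟩ := hcov y hy hyr
    have hxa := norm_sub_le_of_le_of_le hxy ha
    refine ⟨a, hxa, fun b hb => hsep b a ?_⟩
    rw [norm_sub_rev] at hb
    exact norm_sub_le_of_le_of_le hb hxa
  have hsum := sum_map_eq_sum_countP (fun a x => ‖x - t a‖ ≤ δ)
    (fun x => Real.log (max δ ‖x‖)) (fun a => Real.log (max δ ‖t a‖)) s (fun x hx => by
      obtain ⟨a, ha, huniq⟩ := hpart x hx
      exact ⟨a, ha, by rw [max_norm_eq_of_norm_sub_le ha], huniq⟩)
  have hcard := sum_map_eq_sum_countP (fun a x => ‖x - t a‖ ≤ δ)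
    (fun _ => (1 : ℝ)) (fun _ => 1) s (fun x hx => by
      obtain ⟨a, ha, huniq⟩ := hpart x hx
      exact ⟨a, ha, rfl, huniq⟩)
  have hcs : s.card = rootCount r Q := by rw [hs, rootCount, Multiset.countP_eq_card_filter]
  simp only [hcount, mul_one, Finset.sum_const, nsmul_eq_mul, Multiset.map_const',
    Multiset.sum_replicate, Finset.card_univ, hcs] at hcard
  simp only [hcount, ← Finset.mul_sum] at hsum
  rw [sum_map_log _ _ fun x _ => lt_max_of_lt_left hδ] at hsum
  have hprod := congrArg Real.log (polyGauss_mul_prod_filter_eq Q hδ hδr)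
  rw [Real.log_mul (by rw [hgr]; positivity) (Multiset.prod_pos (fun x hx => by
      obtain ⟨b, -, rfl⟩ := Multiset.mem_map.1 hx
      exact lt_max_of_lt_left hδ)).ne', Real.log_mul (by rw [hgδ]; positivity) (by positivity),
    ← hs, hsum, hgr, hgδ, Real.log_pow, Real.log_pow, Real.log_pow] at hprod
  -- By equal distribution the root count is `Fintype.card A * rootCount δ Q`. Bounding it by
  -- `f.kappa r * p ^ N` makes `p ^ N` cancel and turns Jensen's identity into an inequality free of
  -- `Q`.
  have hroot := rootCount_le hf0 hr hgr hg2
  rw [hcard] at hprod hroot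
  have hS : 0 ≤ ∑ a, (Real.log r - Real.log (max δ ‖t a‖)) :=
    Finset.sum_nonneg fun a _ => sub_nonneg.2
      (Real.log_le_log (lt_max_of_lt_left hδ) (max_le hδr (htr a)))
  have hSeq : ∑ a, (Real.log r - Real.log (max δ ‖t a‖))
      = Fintype.card A * Real.log r - ∑ a, Real.log (max δ ‖t a‖) := by
    rw [Finset.sum_sub_distrib, Finset.sum_const, nsmul_eq_mul, Finset.card_univ]
  have hpN' : (0 : ℝ) < (p : ℝ) ^ N := by
    have : (0 : ℝ) < p := by exact_mod_cast (Fact.out : p.Prime).pos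
    positivity
  have key : (p : ℝ) ^ N * (Real.log (f.gauss r) - Real.log (f.gauss δ))
      = rootCount δ Q * ∑ a, (Real.log r - Real.log (max δ ‖t a‖)) := by
    rw [hSeq]
    push_cast at hprod
    linear_combination hprod
  refine le_of_mul_le_mul_left ?_ hpN'
  calc (p : ℝ) ^ N * ((Real.log (f.gauss r) - Real.log (f.gauss δ)) * Fintype.card A)
      = (Fintype.card A * rootCount δ Q) * ∑ a, (Real.log r - Real.log (max δ ‖t a‖)) := by
        linear_combination (Fintype.card A : ℝ) * key
    _ ≤ (f.kappa r * p ^ N) * ∑ a, (Real.log r - Real.log (max δ ‖t a‖)) := by gcongr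
    _ = _ := by ring

end FracPowerSeries

end FracSeries

namespace FracSeries

open scoped ENNReal

/-! ### Haar integrals of locally constant functions -/

section Average

variable {C : Type*} [NormedField C] [IsUltrametricDist C]

/-- By the ultrametric inequality the elements of norm at most `δ` form an open subgroup, of finite
index by compactness. Its cosets all have the same measure `m`, and `t` lists representatives. -/
theorem exists_lintegral_eq_sum (H : AddSubgroup C) [CompactSpace H] [MeasurableSpace H]
    [BorelSpace H] (μ : Measure H) [μ.IsAddHaarMeasure] {δ : ℝ} (hδ : 0 < δ) :
    ∃ (n : ℕ) (t : Fin n → H), (∀ x : H, ∃ a, ‖(x : C) - t a‖ ≤ δ) ∧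
      (∀ a b, ‖(t a : C) - t b‖ ≤ δ → a = b) ∧
      ∃ m : ℝ≥0∞, μ Set.univ = n * m ∧ ∀ g : H → ℝ≥0∞,
        (∀ x y : H, ‖(x : C) - y‖ ≤ δ → g x = g y) → ∫⁻ x, g x ∂μ = m * ∑ a, g (t a) := by
  let U : AddSubgroup H :=
    { carrier := {x | ‖(x : C)‖ ≤ δ}
      zero_mem' := by simpa using hδ.le
      add_mem' := fun {x y} hx hy => (IsUltrametricDist.norm_add_le_max _ _).trans (max_le hx hy)
      neg_mem' := fun {x} hx => by simpa using hx }
  have hUmem : ∀ x : H, x ∈ U ↔ ‖(x : C)‖ ≤ δ := fun _ => Iff.rfl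
  have hUopen : IsOpen (U : Set H) := by
    refine AddSubgroup.isOpen_of_mem_nhds U (g := 0) ?_
    filter_upwards [Metric.ball_mem_nhds (0 : H) hδ] with x hx
    rw [Metric.mem_ball, dist_zero_right] at hx
    exact (hUmem x).2 (le_of_lt hx)
  have hfin : Finite (H ⧸ U) := AddSubgroup.quotient_finite_of_isOpen U hUopen
  let φ := (Finite.equivFin (H ⧸ U)).symm
  let t : Fin (Nat.card (H ⧸ U)) → H := fun a => (φ a).out
  have ht : ∀ a, (QuotientAddGroup.mk (t a) : H ⧸ U) = φ a := fun a => Quotient.out_eq _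
  have hmk : ∀ x y : H, (QuotientAddGroup.mk x : H ⧸ U) = QuotientAddGroup.mk y ↔
      ‖(y : C) - x‖ ≤ δ := by
    intro x y
    rw [QuotientAddGroup.eq, hUmem, AddSubgroup.coe_add, AddSubgroup.coe_neg, neg_add_eq_sub]
  let s : Fin (Nat.card (H ⧸ U)) → Set H := fun a => (fun x => -t a + x) ⁻¹' (U : Set H)
  have hs : ∀ a x, x ∈ s a ↔ ‖(x : C) - t a‖ ≤ δ := by
    intro a x
    rw [← hmk, QuotientAddGroup.eq]
    rfl
  have hcov : ∀ x : H, ∃ a, ‖(x : C) - t a‖ ≤ δ := by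
    intro x
    obtain ⟨a, ha⟩ := φ.surjective (QuotientAddGroup.mk x)
    exact ⟨a, (hmk _ _).1 ((ht a).trans ha)⟩
  have hsep : ∀ a b, ‖(t a : C) - t b‖ ≤ δ → a = b := by
    intro a b hab
    have := (hmk _ _).2 hab
    rw [ht, ht] at this
    exact (φ.injective this).symm
  have hunion : ⋃ a, s a = Set.univ :=
    Set.eq_univ_of_forall fun x => Set.mem_iUnion.2 ((hcov x).imp fun a ha => (hs a x).2 ha)
  have hdisj : Pairwise (Function.onFun Disjoint s) := by
    intro a b hab
    refine Set.disjoint_left.2 fun x ha hb => hab (hsep a b ?_)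
    rw [hs, norm_sub_rev] at ha
    exact norm_sub_le_of_le_of_le ha ((hs b x).1 hb)
  have hmeas : ∀ a, MeasurableSet (s a) := fun a =>
    (hUopen.preimage (continuous_const.add continuous_id)).measurableSet
  have hμs : ∀ a, μ (s a) = μ U := fun a => measure_preimage_add μ (-t a) U
  have hint : ∀ g : H → ℝ≥0∞, (∀ x y : H, ‖(x : C) - y‖ ≤ δ → g x = g y) →
      ∫⁻ x, g x ∂μ = μ U * ∑ a, g (t a) := by
    intro g hg
    rw [← setLIntegral_univ, ← hunion, lintegral_iUnion hmeas hdisj, tsum_fintype, Finset.mul_sum]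
    refine Finset.sum_congr rfl fun a _ => ?_
    rw [setLIntegral_congr_fun (hmeas a) (g := fun _ => g (t a))
      (fun x hx => hg x (t a) ((hs a x).1 hx)), setLIntegral_const, hμs, mul_comm]
  refine ⟨_, t, hcov, hsep, μ U, ?_, hint⟩
  have := hint (fun _ => 1) fun _ _ _ => rfl
  simpa [mul_comm] using this

end Average

/-! ### Divergence of the integral of `v` -/

section Integral

variable {C : Type*} [NormedField C] [IsAlgClosed C] {p : ℕ} [Fact p.Prime] [CharP C p]
variable [IsUltrametricDist C] [CompleteSpace C] {k : ℕ} {f : FracPowerSeries C p}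

theorem lintegral_log_ge (hf : f ∈ LinearSeries C p k) (hf0 : f.coeff ≠ 0) {r δ : ℝ}
    (hδ : 0 < δ) (hδr : δ ≤ r) (H : AddSubgroup C)
    (hH : ∀ x, x ∈ H ↔ f.eval x = 0 ∧ ‖x‖ ≤ r) [CompactSpace H] [MeasurableSpace H] [BorelSpace H]
    (μ : Measure H) [μ.IsAddHaarMeasure] :
    ENNReal.ofReal (Real.log (f.gauss r) - Real.log (f.gauss δ)) * μ Set.univ
      ≤ ENNReal.ofReal (f.kappa r)
        * ∫⁻ x, ENNReal.ofReal (Real.log r - Real.log (max δ ‖(x : C)‖)) ∂μ := by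
  obtain ⟨n, t, hcov, hsep, m, huniv, hint⟩ := exists_lintegral_eq_sum H μ hδ
  have hr : 0 < r := hδ.trans_le hδr
  have hnn : ∀ a, 0 ≤ Real.log r - Real.log (max δ ‖(t a : C)‖) := fun a => sub_nonneg.2
    (Real.log_le_log (lt_max_of_lt_left hδ) (max_le hδr ((hH _).1 (t a).2).2))
  have key := FracPowerSeries.log_gauss_mul_card_le hf hf0 hδ hδr (fun a => (t a : C))
    (fun a => ((hH _).1 (t a).2).1) (fun a => ((hH _).1 (t a).2).2)
    (fun z hz hzr => hcov ⟨z, (hH z).2 ⟨hz, hzr⟩⟩) hsep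
  rw [hint _ fun x y hxy => by rw [max_norm_eq_of_norm_sub_le hxy], huniv]
  rw [← ENNReal.ofReal_sum_of_nonneg fun a _ => hnn a, mul_comm (n : ℝ≥0∞),
    mul_left_comm _ m, mul_left_comm _ m]
  refine mul_le_mul_right ?_ m
  rw [← ENNReal.ofReal_natCast, ← ENNReal.ofReal_mul' (by positivity),
    ← ENNReal.ofReal_mul (FracPowerSeries.kappa_nonneg hf0 hr)]
  refine ENNReal.ofReal_le_ofReal ?_
  simpa using key

omit [IsAlgClosed C] [IsUltrametricDist C] [CompleteSpace C] in
-- Provides a majorant of the integrand in Jensen's inequality that is independent of `δ`.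
theorem ofReal_log_sub_log_max_le (r δ : ℝ) (x : C) :
    ENNReal.ofReal (Real.log r - Real.log (max δ ‖x‖))
      ≤ ENNReal.ofReal |Real.log r| + (val x).toENNReal := by
  by_cases hx : x = 0
  · simp [val, hx]
  · rw [val, if_neg hx, EReal.real_coe_toENNReal]
    refine le_trans (ENNReal.ofReal_le_ofReal ?_) ENNReal.ofReal_add_le
    have := Real.log_le_log (norm_pos_iff.2 hx) (le_max_right δ ‖x‖)
    linarith [le_abs_self (Real.log r)]

theorem haarIntegralValEqTop (hf : f ∈ LinearSeries C p k) (hf0 : f.coeff ≠ 0) {r : ℝ}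
    (hr : 0 < r) (H : AddSubgroup C) (hH : ∀ x, x ∈ H ↔ f.eval x = 0 ∧ ‖x‖ ≤ r)
    (hc : IsCompact (H : Set C)) : HaarIntegralValEqTop H := by
  have hcs : CompactSpace H := isCompact_iff_compactSpace.1 hc
  let _ : MeasurableSpace H := borel H
  have : BorelSpace H := ⟨rfl⟩
  intro μ hμ
  have hμtop : μ Set.univ ≠ ⊤ := isCompact_univ.measure_lt_top.ne
  have hμ0 : μ Set.univ ≠ 0 := (isOpen_univ.measure_pos μ Set.univ_nonempty).ne'
  constructor
  · by_contra htop
    set B := ENNReal.ofReal (f.kappa r) *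
      (ENNReal.ofReal |Real.log r| * μ Set.univ + ∫⁻ x : H, (val (x : C)).toENNReal ∂μ) with hB
    have hBtop : B ≠ ⊤ := ENNReal.mul_ne_top ENNReal.ofReal_ne_top
      (ENNReal.add_ne_top.2 ⟨ENNReal.mul_ne_top ENNReal.ofReal_ne_top hμtop, htop⟩)
    have hbound : ∀ δ, 0 < δ → δ ≤ r →
        ENNReal.ofReal (Real.log (f.gauss r) - Real.log (f.gauss δ)) * μ Set.univ ≤ B := by
      intro δ hδ hδr
      refine (lintegral_log_ge hf hf0 hδ hδr H hH μ).trans (mul_le_mul_right ?_ _)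
      refine (lintegral_mono (μ := μ) fun x : H => ofReal_log_sub_log_max_le r δ (x : C)).trans ?_
      rw [lintegral_add_left measurable_const, lintegral_const]
    have hM := FracPowerSeries.gauss_pos hf0 hr
    set L := (B / μ Set.univ).toReal with hL
    have hLB : ENNReal.ofReal L = B / μ Set.univ :=
      ENNReal.ofReal_toReal (ENNReal.div_ne_top hBtop hμ0)
    -- A finite integral would bound `log (f.gauss r) - log (f.gauss δ)` by `L` for all `δ ≤ r`; the
    -- factor `exp (-(L + 1))` makes this difference exceed `L + 1`.
    obtain ⟨δ, hδ, hδr, hlt⟩ := FracPowerSeries.exists_gauss_lt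
      (FracPowerSeries.exponent_pos hf) (show 0 < f.gauss r * Real.exp (-(L + 1)) by positivity) hr
    have h1 := (ENNReal.le_div_iff_mul_le (Or.inl hμ0) (Or.inl hμtop)).2 (hbound δ hδ hδr)
    rw [← hLB, ENNReal.ofReal_le_ofReal_iff ENNReal.toReal_nonneg] at h1
    have h2 := Real.log_lt_log (FracPowerSeries.gauss_pos hf0 hδ) hlt
    rw [Real.log_mul hM.ne' (Real.exp_pos _).ne', Real.log_exp] at h2
    linarith
  -- On the disk of radius `r` the negative part of `v` is at most `|log r|`, and the total mass is
  -- finite.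
  · refine ((lintegral_mono (g := fun _ => ENNReal.ofReal |Real.log r|) fun x => ?_).trans_lt
      ?_).ne
    · by_cases hx : (x : C) = 0
      · simp [val, hx]
      · simp only [val, if_neg hx]
        rw [← EReal.coe_neg, neg_neg, EReal.real_coe_toENNReal]
        refine ENNReal.ofReal_le_ofReal ((Real.log_le_log (norm_pos_iff.2 hx) ?_).trans
          (le_abs_self _))
        exact ((hH _).1 x.2).2
    · rw [lintegral_const]
      exact ENNReal.mul_lt_top ENNReal.ofReal_lt_top hμtop.lt_top

end Integral

end FracSeries

/-! ### The theorem -/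

theorem mainTheorem3 {C : Type*} [NormedField C] [IsUltrametricDist C] [CompleteSpace C]
    [IsAlgClosed C] (p : ℕ) [Fact p.Prime] [CharP C p]
    (k : ℕ) {F : Type*} [Field F] [Algebra F C] (hF : Nat.card F = p ^ k) :
    (∀ f : FracSeries.FracPowerSeries C p, ¬ f.IsConstant → ∀ c : C,
      LocallyCompactSpace {z : C | f.eval z = c} ∧
      (IsCompact {z : C | f.eval z = c} ↔
        ∃ e : FracSeries.Exponents p, IsGreatest {e | f.coeff e ≠ 0} e)) ∧
    (∀ f ∈ FracSeries.LinearSeries C p k, f.coeff ≠ 0 →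
      ∃ G : Submodule F C, (G : Set C) = {z : C | f.eval z = 0} ∧
        (∀ (r : ℝ) (hr : 0 < r), FracSeries.MemClassG r hr G) ∧
        (DiscreteTopology G ↔
          ∃ N : ℤ, ∀ n < N, f.coeff (FracSeries.qExponent p k n) = 0) ∧
        (IsCompact (G : Set C) ↔
          ∃ N : ℤ, ∀ n > N, f.coeff (FracSeries.qExponent p k n) = 0)) := by
  open FracSeries FracSeries.FracPowerSeries in
  refine ⟨fun f hf c => ?_, fun f hf hf0 => ?_⟩
  · rw [fiber_eq f c]
    have h0 := subConst_coeff_ne_zero f hf c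
    refine ⟨locallyCompactSpace_zeros h0, (isCompact_zeros_iff h0).trans ?_⟩
    exact exists_congr fun e => isGreatest_subConst_iff f hf c e
  · have hq := one_lt_of_card hF
    have hcompact : ∀ R : ℝ, 0 < R → IsCompact {x | x ∈ ker hf hF ∧ ‖x‖ ≤ R} :=
      fun R hR => isCompact_zeros_inter_ball hf0 hR
    refine ⟨ker hf hF, rfl, fun r hr => ?_, ?_, ?_⟩
    · exact ⟨hcompact r hr, haarIntegralValEqTop hf hf0 hr _ (fun x => Iff.rfl) (hcompact r hr),
        countable_quotient hcompact hr, fun g hg => tendsto_norm_atTop hcompact hr hg.1⟩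
    · rw [discreteTopology_iff, ← exists_isLeast_iff hf hq hf0]
      exact ⟨fun ⟨δ, hδ, h⟩ => exists_isLeast_of_zeros hf0 hδ h,
        fun ⟨e, he⟩ => exists_ne_zero_of_isLeast he⟩
    · rw [← exists_isGreatest_iff hf hq hf0]
      exact isCompact_zeros_iff hf0
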